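/- A residuated lattice is a bounded lattice $(L,\wedge,\vee,0,1)$ with a commutative ordered monoid operation $\odot$ with unit $1$ and an operation $\to$ such that $z\le x\to y$ iff $x\odot z\le y$. It is a BL-algebra if $(x\to y)\vee(y\to x)=1$ and $x\odot(x\to y)=x\wedge y$ for all $x,y$, and a BL-chain if moreover its order is total. It is an MV-algebra if, with $x^*=x\to 0$ and $x\oplus y=(x^*\odot y^*)^*$, $(L,\oplus,{}^*,0)$ is an MV-algebra: $(L,\oplus,0)$ is an abelian monoid, $x^{**}=x$, $x\oplus 0^*=0^*$ and $(x^*\oplus y)^*\oplus y=(y^*\oplus x)^*\oplus x$. For a commutative ring $A$, $\mathrm{Id}(A)$ is the residuated lattice of ideals of $A$ with $\wedge=\cap$, $\vee=+$, $\odot$ the product of ideals, $I\to J=(J:I)$, $0=\{0\}$ and $1=A$. The ordinal product $L_1\boxtimes L_2$ of two residuated lattices is the residuated lattice on $L_1\cup L_2$, where $1_1$ and $0_2$ are identified and $L_1$ and $L_2$ are otherwise disjoint, in which $L_1$ lies below $L_2$, the operations $\wedge,\vee,\odot$ extend those of $L_1$ and $L_2$, $x\odot y=y\odot x=x$ for $x\in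 L_1\setminus\{1_1\}$, $y\in L_2$, and $x\to y$ is $1_2$ if $x\le y$, is $x\to_i y$ if $x\not\le y$ and $x,y\in L_i$, and is $y$ if $x\in L_2$, $y\in L_1\setminus\{1_1\}$. Let $\pi(n)$ be the number of decompositions of $n$ into at least two factors greater than $1$, disregarding the order of the factors. (i) Let $\mathcal K$ be the smallest class of residuated lattices that contains $\mathrm{Id}(\mathbb Z_{2^k})$ for all $k\ge 1$ and $\mathrm{Id}(\mathbb Z_2\times\mathbb Z_2)$, and contains $A\boxtimes B$ whenever $A,B\in\mathcal K$ and $A$ is totally ordered. Every BL-algebra with $n$ elements, $2\le n\le 5$, that is not an MV-algebra is isomorphic to an ordinal product $A\boxtimes B$ of a BL-chain $A\in\mathcal K$ and a BL-algebra $B\in\mathcal K$, each with at least two elements. (ii) Let $|\mathcal{BL}_n|$ and $|\mathcal{MV}_n|$ be the numbers of isomorphism classes of BL-algebras and of MV-algebras with $n$ elements. Then $$|\mathcal{BL}_2|=|\mathcal{MV}_2|=\pi(2)+1=1,$$ $$|\mathcal{BL}_3|=|\mathcal{MV}_3|+|\mathcal{BL}_2|=\pi(3)+\pi(2)+2=2,$$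 $$|\mathcal{BL}_4|=|\mathcal{MV}_4|+|\mathcal{BL}_3|+|\mathcal{BL}_2|=\pi(4)+\pi(3)+2\pi(2)+4=5,$$ $$|\mathcal{BL}_5|=|\mathcal{MV}_5|+|\mathcal{BL}_4|+|\mathcal{BL}_3|+|\mathcal{BL}_2|=\pi(5)+\pi(4)+2\pi(3)+4\pi(2)+8=9.$$ -/

import Mathlib

universe u v w

/-- A commutative residuated lattice `(L, ∧, ∨, ⊙, →, 0, 1)`: a bounded lattice (with `0 = ⊥` and
`1 = ⊤`), a commutative ordered monoid `(L, ⊙, 1)` (written multiplicatively), and a residuum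
`imp x y`, written `x ⇝ y`, with `z ≤ x → y` iff `x ⊙ z ≤ y`. -/
class ResiduatedLattice (L : Type u) extends Lattice L, BoundedOrder L, CommMonoid L where
  /-- the residuum `x → y` -/
  imp : L → L → L
  one_eq_top : (1 : L) = ⊤
  mul_mono : ∀ x y z : L, x ≤ y → x * z ≤ y * z
  le_imp_iff : ∀ x y z : L, z ≤ imp x y ↔ x * z ≤ y

infixr:60 " ⇝ " => ResiduatedLattice.imp

/-- The negation `x* = x → 0`. -/
def rneg {L : Type u} [ResiduatedLattice L] (x : L) : L := x ⇝ ⊥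

/-- A BL-algebra: a residuated lattice with prelinearity and divisibility. -/
structure IsBL (L : Type u) [ResiduatedLattice L] : Prop where
  prel : ∀ x y : L, (x ⇝ y) ⊔ (y ⇝ x) = ⊤
  div : ∀ x y : L, x * (x ⇝ y) = x ⊓ y

/-- The lattice order is total. -/
def IsChainAlg (L : Type u) [ResiduatedLattice L] : Prop := ∀ x y : L, x ≤ y ∨ y ≤ x

/-- Isomorphisms of residuated lattices: bijections that preserve all operations. -/
structure ResIso (L : Type u) (M : Type v) [ResiduatedLattice L] [ResiduatedLattice M]
    extends L ≃ M where
  map_inf : ∀ x y : L, toFun (x ⊓ y) = toFun x ⊓ toFun y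
  map_sup : ∀ x y : L, toFun (x ⊔ y) = toFun x ⊔ toFun y
  map_mul : ∀ x y : L, toFun (x * y) = toFun x * toFun y
  map_imp : ∀ x y : L, toFun (x ⇝ y) = (toFun x ⇝ toFun y)
  map_bot : toFun ⊥ = ⊥
  map_top : toFun ⊤ = ⊤

namespace ResIso

def refl (L : Type u) [ResiduatedLattice L] : ResIso L L :=
  { Equiv.refl L with
    map_inf := fun _ _ => rfl
    map_sup := fun _ _ => rfl
    map_mul := fun _ _ => rfl
    map_imp := fun _ _ => rfl
    map_bot := rfl
    map_top := rfl }

def symm {L : Type u} {M : Type v} [ResiduatedLattice L] [ResiduatedLattice M]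
    (e : ResIso L M) : ResIso M L :=
  { e.toEquiv.symm with
    map_inf := fun x y => e.toEquiv.symm_apply_eq.2 (by
      have h := e.map_inf (e.toEquiv.symm x) (e.toEquiv.symm y)
      have hx := e.toEquiv.apply_symm_apply x
      have hy := e.toEquiv.apply_symm_apply y
      exact (h.trans (congrArg₂ _ hx hy)).symm)
    map_sup := fun x y => e.toEquiv.symm_apply_eq.2 (by
      have h := e.map_sup (e.toEquiv.symm x) (e.toEquiv.symm y)
      have hx := e.toEquiv.apply_symm_apply x
      have hy := e.toEquiv.apply_symm_apply y
      exact (h.trans (congrArg₂ _ hx hy)).symm)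
    map_mul := fun x y => e.toEquiv.symm_apply_eq.2 (by
      have h := e.map_mul (e.toEquiv.symm x) (e.toEquiv.symm y)
      have hx := e.toEquiv.apply_symm_apply x
      have hy := e.toEquiv.apply_symm_apply y
      exact (h.trans (congrArg₂ _ hx hy)).symm)
    map_imp := fun x y => e.toEquiv.symm_apply_eq.2 (by
      have h := e.map_imp (e.toEquiv.symm x) (e.toEquiv.symm y)
      have hx := e.toEquiv.apply_symm_apply x
      have hy := e.toEquiv.apply_symm_apply y
      exact (h.trans (congrArg₂ _ hx hy)).symm)
    map_bot := e.toEquiv.symm_apply_eq.2 e.map_bot.symm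
    map_top := e.toEquiv.symm_apply_eq.2 e.map_top.symm }

def trans {L : Type u} {M : Type v} {N : Type w} [ResiduatedLattice L] [ResiduatedLattice M]
    [ResiduatedLattice N] (e : ResIso L M) (f : ResIso M N) : ResIso L N :=
  { e.toEquiv.trans f.toEquiv with
    map_inf := fun x y => (congrArg f.toFun (e.map_inf x y)).trans (f.map_inf _ _)
    map_sup := fun x y => (congrArg f.toFun (e.map_sup x y)).trans (f.map_sup _ _)
    map_mul := fun x y => (congrArg f.toFun (e.map_mul x y)).trans (f.map_mul _ _)
    map_imp := fun x y => (congrArg f.toFun (e.map_imp x y)).trans (f.map_imp _ _)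
    map_bot := (congrArg f.toFun e.map_bot).trans f.map_bot
    map_top := (congrArg f.toFun e.map_top).trans f.map_top }

end ResIso

/-- An MV-algebra `(L, ⊕, *, 0)`. -/
class MVAlgebra (L : Type u) where
  oplus : L → L → L
  neg : L → L
  zero : L
  oplus_assoc : ∀ x y z, oplus (oplus x y) z = oplus x (oplus y z)
  oplus_comm : ∀ x y, oplus x y = oplus y x
  oplus_zero : ∀ x, oplus x zero = x
  neg_neg : ∀ x, neg (neg x) = x
  oplus_neg_zero : ∀ x, oplus x (neg zero) = neg zero
  neg_oplus : ∀ x y, oplus (neg (oplus (neg x) y)) y = oplus (neg (oplus (neg y) x)) x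

/-- The residuated lattice `L` is an MV-algebra: `(L, ⊕, *, 0)` with `x* = x → 0` and
`x ⊕ y = (x* ⊙ y*)*` is an MV-algebra.  (Then `x ⊙ y = (x* ⊕ y*)*` and `x → y = x* ⊕ y`, so `L` is
the residuated lattice that belongs to this MV-algebra.) -/
def IsMV (L : Type u) [ResiduatedLattice L] : Prop :=
  ∃ M : MVAlgebra L, M.zero = ⊥ ∧ (∀ x, M.neg x = rneg x) ∧
    ∀ x y, M.oplus x y = rneg (rneg x * rneg y)

/-- Isomorphisms of MV-algebras. -/
structure MVIso (L : Type u) (M : Type v) [MVAlgebra L] [MVAlgebra M] extends L ≃ M where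
  map_oplus : ∀ x y : L, toFun (MVAlgebra.oplus x y) = MVAlgebra.oplus (toFun x) (toFun y)
  map_neg : ∀ x : L, toFun (MVAlgebra.neg x) = MVAlgebra.neg (toFun x)
  map_zero : toFun MVAlgebra.zero = MVAlgebra.zero

namespace MVIso

def refl (L : Type u) [MVAlgebra L] : MVIso L L :=
  { Equiv.refl L with
    map_oplus := fun _ _ => rfl
    map_neg := fun _ => rfl
    map_zero := rfl }

def symm {L : Type u} {M : Type v} [MVAlgebra L] [MVAlgebra M] (e : MVIso L M) : MVIso M L :=
  { e.toEquiv.symm with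
    map_oplus := fun x y => e.toEquiv.symm_apply_eq.2 (by
      have h := e.map_oplus (e.toEquiv.symm x) (e.toEquiv.symm y)
      have hx := e.toEquiv.apply_symm_apply x
      have hy := e.toEquiv.apply_symm_apply y
      exact (h.trans (congrArg₂ _ hx hy)).symm)
    map_neg := fun x => e.toEquiv.symm_apply_eq.2 (by
      have h := e.map_neg (e.toEquiv.symm x)
      have hx := e.toEquiv.apply_symm_apply x
      exact (h.trans (congrArg _ hx)).symm)
    map_zero := e.toEquiv.symm_apply_eq.2 e.map_zero.symm }

def trans {L : Type u} {M : Type v} {N : Type w} [MVAlgebra L] [MVAlgebra M] [MVAlgebra N]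
    (e : MVIso L M) (f : MVIso M N) : MVIso L N :=
  { e.toEquiv.trans f.toEquiv with
    map_oplus := fun x y => (congrArg f.toFun (e.map_oplus x y)).trans (f.map_oplus _ _)
    map_neg := fun x => (congrArg f.toFun (e.map_neg x)).trans (f.map_neg _)
    map_zero := (congrArg f.toFun e.map_zero).trans f.map_zero }

end MVIso

/-- The residuated lattice `Id(A)` of ideals of a commutative ring `A`, with intersection, sum and
product of ideals, and `I → J = (J : I) = {x | x I ⊆ J}`. -/
noncomputable instance idealResiduatedLattice (A : Type u) [CommRing A] :
    ResiduatedLattice (Ideal A) :=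
  { (inferInstance : Lattice (Ideal A)), (inferInstance : BoundedOrder (Ideal A)),
    (inferInstance : CommMonoid (Ideal A)) with
    imp := fun I J => J.colon (I : Set A)
    one_eq_top := Ideal.one_eq_top
    mul_mono := fun _ _ _ h => Ideal.mul_mono_left h
    le_imp_iff := fun I J K => by
      rw [mul_comm, Ideal.mul_le]
      constructor
      · intro h r hr s hs
        exact Submodule.mem_colon.1 (h hr) s hs
      · intro h r hr
        exact Submodule.mem_colon.2 fun s hs => h r hr s hs }

section OrdinalProduct

open Classical

/-- The carrier of the ordinal product `L₁ ⊠ L₂`: the union of `L₁` and `L₂` with `1₁` and `0₂`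
identified, realized as the disjoint union of `L₁ \ {1₁}` and `L₂`. -/
inductive OrdProd (L₁ : Type u) (L₂ : Type v) [ResiduatedLattice L₁] : Type (max u v) where
  | lo (x : L₁) (hx : x ≠ ⊤) : OrdProd L₁ L₂
  | hi (x : L₂) : OrdProd L₁ L₂

namespace OrdProd

variable {L₁ : Type u} {L₂ : Type v} [ResiduatedLattice L₁] [ResiduatedLattice L₂]

/-- The inclusion of `L₁`, with `1₁ ↦ 0₂`. -/
noncomputable def inl (x : L₁) : OrdProd L₁ L₂ := if hx : x = ⊤ then hi ⊥ else lo x hx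

/-- The order. -/
def le : OrdProd L₁ L₂ → OrdProd L₁ L₂ → Prop
  | lo x _, lo y _ => x ≤ y
  | lo _ _, hi _ => True
  | hi _, lo _ _ => False
  | hi x, hi y => x ≤ y

/-- The meet. -/
noncomputable def inf : OrdProd L₁ L₂ → OrdProd L₁ L₂ → OrdProd L₁ L₂
  | lo x _, lo y _ => inl (x ⊓ y)
  | lo x hx, hi _ => lo x hx
  | hi _, lo y hy => lo y hy
  | hi x, hi y => hi (x ⊓ y)

/-- The join; `x ⊔ y` may be `1₁ = 0₂` for `x, y < 1₁`. -/
noncomputable def sup : OrdProd L₁ L₂ → OrdProd L₁ L₂ → OrdProd L₁ L₂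
  | lo x _, lo y _ => inl (x ⊔ y)
  | lo _ _, hi y => hi y
  | hi x, lo _ _ => hi x
  | hi x, hi y => hi (x ⊔ y)

/-- The product. -/
noncomputable def mul : OrdProd L₁ L₂ → OrdProd L₁ L₂ → OrdProd L₁ L₂
  | lo x _, lo y _ => inl (x * y)
  | lo x hx, hi _ => lo x hx
  | hi _, lo y hy => lo y hy
  | hi x, hi y => hi (x * y)

/-- The residuum. -/
noncomputable def imp : OrdProd L₁ L₂ → OrdProd L₁ L₂ → OrdProd L₁ L₂
  | lo x _, lo y _ => if x ≤ y then hi ⊤ else inl (x ⇝ y)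
  | lo _ _, hi _ => hi ⊤
  | hi _, lo y hy => lo y hy
  | hi x, hi y => hi (x ⇝ y)

theorem inl_of_ne (x : L₁) (hx : x ≠ ⊤) : (inl x : OrdProd L₁ L₂) = lo x hx := dif_neg hx

theorem inl_of_eq (x : L₁) (hx : x = ⊤) : (inl x : OrdProd L₁ L₂) = hi ⊥ := dif_pos hx

theorem rmul_le_left {L : Type u} [ResiduatedLattice L] (x y : L) : x * y ≤ x := by
  have h := ResiduatedLattice.mul_mono y 1 x (by rw [ResiduatedLattice.one_eq_top]; exact le_top)
  rwa [one_mul, mul_comm] at h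

theorem rmul_ne_top {L : Type u} [ResiduatedLattice L] (x y : L) (hx : x ≠ ⊤) : x * y ≠ ⊤ :=
  fun h => hx (top_le_iff.1 (h ▸ rmul_le_left x y))

theorem rinf_ne_top {L : Type u} [ResiduatedLattice L] (x y : L) (hx : x ≠ ⊤) : x ⊓ y ≠ ⊤ :=
  fun h => hx (top_le_iff.1 (h ▸ inf_le_left))

theorem rimp_ne_top {L : Type u} [ResiduatedLattice L] (x y : L) (h : ¬ x ≤ y) :
    (x ⇝ y) ≠ ⊤ := by
  intro e
  apply h
  have h' := (ResiduatedLattice.le_imp_iff x y 1).1 (e ▸ le_top)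
  rwa [mul_one] at h'

@[simp] theorem le_lo_lo (x y : L₁) (hx : x ≠ ⊤) (hy : y ≠ ⊤) :
    le (lo x hx : OrdProd L₁ L₂) (lo y hy) ↔ x ≤ y := Iff.rfl

@[simp] theorem le_lo_hi (x : L₁) (y : L₂) (hx : x ≠ ⊤) : le (lo x hx) (hi y) := trivial

@[simp] theorem le_hi_lo (x : L₂) (y : L₁) (hy : y ≠ ⊤) : ¬ le (hi x) (lo y hy) := id

@[simp] theorem le_hi_hi (x y : L₂) : le (hi x : OrdProd L₁ L₂) (hi y) ↔ x ≤ y := Iff.rfl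

@[simp] theorem inl_le_lo (x y : L₁) (hy : y ≠ ⊤) : le (inl x : OrdProd L₁ L₂) (lo y hy) ↔ x ≤ y := by
  by_cases hx : x = ⊤
  · subst hx
    rw [inl_of_eq _ rfl]
    simp [hy]
  · rw [inl_of_ne x hx]
    rfl

@[simp] theorem lo_le_inl (x y : L₁) (hx : x ≠ ⊤) : le (lo x hx : OrdProd L₁ L₂) (inl y) ↔ x ≤ y := by
  by_cases hy : y = ⊤
  · subst hy
    rw [inl_of_eq _ rfl]
    simp
  · rw [inl_of_ne y hy]
    rfl

@[simp] theorem inl_le_hi (x : L₁) (y : L₂) : le (inl x : OrdProd L₁ L₂) (hi y) := by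
  by_cases hx : x = ⊤
  · rw [inl_of_eq _ hx]
    exact (bot_le : (⊥ : L₂) ≤ y)
  · rw [inl_of_ne x hx]
    trivial

/-- The ordinal product `L₁ ⊠ L₂` of residuated lattices. -/
noncomputable instance residuatedLattice : ResiduatedLattice (OrdProd L₁ L₂) where
  le := le
  inf := inf
  sup := sup
  mul := mul
  imp := imp
  bot := inl ⊥
  top := hi ⊤
  one := hi ⊤
  le_refl a := by cases a <;> simp
  le_trans a b c := by
    have key : ∀ a b c : OrdProd L₁ L₂, le a b → le b c → le a c := by
      rintro (⟨x, hx⟩ | x) (⟨y, hy⟩ | y) (⟨z, hz⟩ | z) h h'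
      · exact le_trans (α := L₁) h h'
      · trivial
      · exact h'.elim
      · trivial
      · exact h.elim
      · exact h.elim
      · exact h'.elim
      · exact le_trans (α := L₂) h h'
    exact key a b c
  le_antisymm a b := by
    have key : ∀ a b : OrdProd L₁ L₂, le a b → le b a → a = b := by
      rintro (⟨x, hx⟩ | x) (⟨y, hy⟩ | y) h h'
      · obtain rfl : x = y := le_antisymm h h'
        rfl
      · exact h'.elim
      · exact h.elim
      · exact congrArg hi (le_antisymm h h')
    exact key a b
  inf_le_left a b := by cases a <;> cases b <;> simp [inf]
  inf_le_right a b := by cases a <;> cases b <;> simp [inf]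
  le_inf a b c := by cases a <;> cases b <;> cases c <;> simp +contextual [inf]
  le_sup_left a b := by cases a <;> cases b <;> simp [sup]
  le_sup_right a b := by cases a <;> cases b <;> simp [sup]
  sup_le a b c := by cases a <;> cases b <;> cases c <;> simp +contextual [sup]
  bot_le a := by
    cases a
    · exact (inl_le_lo _ _ _).2 bot_le
    · exact inl_le_hi _ _
  le_top a := by cases a <;> simp
  mul_assoc a b c := by
    have key : ∀ a b c : OrdProd L₁ L₂, mul (mul a b) c = mul a (mul b c) := by
      rintro (⟨x, hx⟩ | x) (⟨y, hy⟩ | y) (⟨z, hz⟩ | z) <;>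
        simp [mul, inl_of_ne, rmul_ne_top, *, mul_assoc]
    exact key a b c
  mul_comm a b := by
    have key : ∀ a b : OrdProd L₁ L₂, mul a b = mul b a := by
      rintro (⟨x, hx⟩ | x) (⟨y, hy⟩ | y) <;> simp [mul, mul_comm]
    exact key a b
  one_mul a := by
    have key : ∀ a : OrdProd L₁ L₂, mul (hi ⊤) a = a := by
      rintro (⟨x, hx⟩ | x) <;> simp [mul, ← ResiduatedLattice.one_eq_top]
    exact key a
  mul_one a := by
    have key : ∀ a : OrdProd L₁ L₂, mul a (hi ⊤) = a := by
      rintro (⟨x, hx⟩ | x) <;> simp [mul, ← ResiduatedLattice.one_eq_top]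
    exact key a
  one_eq_top := rfl
  mul_mono a b c := by
    have key : ∀ a b c : OrdProd L₁ L₂, le a b → le (mul a c) (mul b c) := by
      rintro (⟨x, hx⟩ | x) (⟨y, hy⟩ | y) (⟨z, hz⟩ | z) h
      · simp only [mul, inl_of_ne _ (rmul_ne_top _ _ hx), inl_of_ne _ (rmul_ne_top _ _ hy)]
        exact ResiduatedLattice.mul_mono _ _ _ h
      · exact h
      · simp only [mul, inl_of_ne _ (rmul_ne_top _ _ hx)]
        exact (mul_comm x z).le.trans (rmul_le_left z x)
      · trivial
      · exact h.elim
      · exact h.elim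
      · exact le_refl z
      · exact ResiduatedLattice.mul_mono x y z h
    exact key a b c
  le_imp_iff a b c := by
    have key : ∀ a b c : OrdProd L₁ L₂, le c (imp a b) ↔ le (mul a c) b := by
      rintro (⟨x, hx⟩ | x) (⟨y, hy⟩ | y) (⟨z, hz⟩ | z)
      · simp only [mul, imp, inl_le_lo]
        split_ifs with h
        · simpa using (rmul_le_left x z).trans h
        · rw [lo_le_inl]
          exact ResiduatedLattice.le_imp_iff x y z
      · simp only [mul, imp]
        split_ifs with h
        · simpa using h
        · rw [inl_of_ne _ (rimp_ne_top x y h)]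
          simpa using h
      · simp [mul, imp]
      · simp [mul, imp]
      · simp [mul, imp]
      · simp [mul, imp]
      · simp [mul, imp]
      · exact ResiduatedLattice.le_imp_iff x y z
    exact key a b c

end OrdProd

end OrdinalProduct

/-- The algebras built from the ideal lattices `Id(ℤ/2ᵏ)` (`k ≥ 1`) and `Id(ℤ/2 × ℤ/2)` by
ordinal products whose first factor is a chain. -/
inductive BuiltFromIdeals : (L : Type) → ResiduatedLattice L → Prop where
  | zmod (k : ℕ) (hk : 1 ≤ k) :
      BuiltFromIdeals (Ideal (ZMod (2 ^ k))) (idealResiduatedLattice (ZMod (2 ^ k)))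
  | zmod_prod :
      BuiltFromIdeals (Ideal (ZMod 2 × ZMod 2)) (idealResiduatedLattice (ZMod 2 × ZMod 2))
  | ordProd (A B : Type) (iA : ResiduatedLattice A) (iB : ResiduatedLattice B) :
      BuiltFromIdeals A iA → BuiltFromIdeals B iB → IsChainAlg A →
      BuiltFromIdeals (OrdProd A B) OrdProd.residuatedLattice

/-- The BL-algebra structures on `{0, …, n - 1}`, up to isomorphism. -/
def blSetoid (n : ℕ) : Setoid {R : ResiduatedLattice (Fin n) // @IsBL (Fin n) R} where
  r R S := Nonempty (@ResIso (Fin n) (Fin n) R.1 S.1)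
  iseqv :=
    { refl := fun R => ⟨@ResIso.refl (Fin n) R.1⟩
      symm := fun {R S} ⟨e⟩ => ⟨@ResIso.symm (Fin n) (Fin n) R.1 S.1 e⟩
      trans := fun {R S T} ⟨e⟩ ⟨f⟩ =>
        ⟨@ResIso.trans (Fin n) (Fin n) (Fin n) R.1 S.1 T.1 e f⟩ }

/-- The number of non-isomorphic BL-algebras with `n` elements. -/
noncomputable def numBL (n : ℕ) : ℕ := Nat.card (Quotient (blSetoid n))

/-- The MV-algebra structures on `{0, …, n - 1}`, up to isomorphism. -/
def mvSetoid (n : ℕ) : Setoid (MVAlgebra (Fin n)) where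
  r R S := Nonempty (@MVIso (Fin n) (Fin n) R S)
  iseqv :=
    { refl := fun R => ⟨@MVIso.refl (Fin n) R⟩
      symm := fun {R S} ⟨e⟩ => ⟨@MVIso.symm (Fin n) (Fin n) R S e⟩
      trans := fun {R S T} ⟨e⟩ ⟨f⟩ => ⟨@MVIso.trans (Fin n) (Fin n) (Fin n) R S T e f⟩ }

/-- The number of non-isomorphic MV-algebras with `n` elements. -/
noncomputable def numMV (n : ℕ) : ℕ := Nat.card (Quotient (mvSetoid n))

/-- `π(n)`: the number of decompositions of `n` into at least two factors greater than `1`,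
regardless of the order of the factors. -/
noncomputable def numFactorizations (n : ℕ) : ℕ :=
  Set.ncard {s : Multiset ℕ | 2 ≤ Multiset.card s ∧ (∀ a ∈ s, 1 < a) ∧ s.prod = n}

/-! A finite BL-chain is determined by its length and the places of its idempotents. Across an
idempotent `e` the product is forced: `x ≤ e ≤ y` gives `x ⊙ y = x`. Between neighbouring
idempotents multiplication by the predecessor of the upper one lowers the rank by exactly one, so
the segment is a Łukasiewicz chain (`IsRanking.rank_mul_between`, `IsRanking.nonempty_resIso`).
Conversely, cutting at interior idempotents and gluing copies of `Id(ℤ/2ᵏ)`, which has no interior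
idempotent, realizes every set of places that contains both ends (`exists_chain_model`). Hence there
are `2^(k-1)` BL-chains with `k + 1 ≥ 2` elements.

If `x, y` are incomparable, then `p = x → y` and `q = y → x` are incomparable with join `1`, and `p
∧ q, p, q, 1` form a square. If `p ∧ q = 0`, distributivity makes the cardinality a product of two
factors at least `2`, which for at most five elements leaves the square itself; otherwise `0` is a
fifth element below the square. In both cases every element is idempotent, so the order fixes the
algebra (`IsBL.nonchain_cases`). This gives one non-chain each for four and five elements.

MV-algebras correspond to BL-algebras with `x** = x`. An idempotent comparable to everything is then
`0` or `1`, so the MV-algebras with at most five elements are the chains without interior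
idempotents and the square. A BL-algebra in this range that is not MV is therefore a chain with an
interior idempotent, which can be cut there, or the square with a new bottom. -/

namespace ResiduatedLattice

/-! ### Arithmetic of residuated lattices -/

section Basic

variable {L : Type u} [ResiduatedLattice L]

theorem mul_le_left (x y : L) : x * y ≤ x := OrdProd.rmul_le_left x y

theorem mul_le_right (x y : L) : x * y ≤ y := by
  rw [mul_comm]
  exact mul_le_left y x

theorem mul_le_mul_of_le {x y z w : L} (h : x ≤ y) (h' : z ≤ w) : x * z ≤ y * w := by
  refine (mul_mono x y z h).trans ?_
  rw [mul_comm y z, mul_comm y w]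
  exact mul_mono z w y h'

theorem mul_top (x : L) : x * ⊤ = x := by rw [← one_eq_top, mul_one]

theorem top_mul (x : L) : ⊤ * x = x := by rw [← one_eq_top, one_mul]

theorem mul_bot (x : L) : x * ⊥ = ⊥ := le_bot_iff.1 (mul_le_right x ⊥)

theorem imp_eq_top {x y : L} : (x ⇝ y) = ⊤ ↔ x ≤ y := by
  rw [← top_le_iff, le_imp_iff, mul_top]

theorem mul_imp_le (x y : L) : x * (x ⇝ y) ≤ y := (le_imp_iff x y _).1 le_rfl

theorem le_imp_self (x y : L) : y ≤ (x ⇝ y) := (le_imp_iff x y y).2 (mul_le_right x y)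

theorem mul_sup_eq (x y z : L) : x * (y ⊔ z) = x * y ⊔ x * z := by
  apply le_antisymm
  · rw [← le_imp_iff]
    exact sup_le ((le_imp_iff _ _ _).2 le_sup_left) ((le_imp_iff _ _ _).2 le_sup_right)
  · exact sup_le (mul_le_mul_of_le le_rfl le_sup_left) (mul_le_mul_of_le le_rfl le_sup_right)

theorem idem_mul_of_le {e x y : L} (he : e * e = e) (hx : e ≤ x) (hy : e ≤ y) : e ≤ x * y := by
  rw [← he]
  exact mul_le_mul_of_le hx hy

end Basic

end ResiduatedLattice

open ResiduatedLattice

/-! ### Divisibility and idempotents in BL-algebras -/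

namespace IsBL

variable {L : Type u} [ResiduatedLattice L]

theorem of_isChainAlg (hc : IsChainAlg L) (h : ∀ x y : L, y ≤ x → ∃ z, x * z = y) : IsBL L where
  prel x y := by
    rcases hc x y with h | h
    · rw [imp_eq_top.2 h, top_sup_eq]
    · rw [imp_eq_top.2 h, sup_top_eq]
  div x y := by
    refine le_antisymm (le_inf (mul_le_left _ _) (mul_imp_le _ _)) ?_
    obtain ⟨z, hz⟩ := h x (x ⊓ y) inf_le_left
    rw [← hz]
    refine mul_le_mul_of_le le_rfl ((le_imp_iff _ _ _).2 ?_)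
    rw [hz]
    exact inf_le_right

theorem exists_mul_eq (hL : IsBL L) {x y : L} (h : y ≤ x) : ∃ z, x * z = y :=
  ⟨x ⇝ y, by rw [hL.div, inf_eq_right.2 h]⟩

/-- Divisibility writes `e ⊓ x` as a multiple of `e`, and `e` fixes its multiples. -/
theorem idem_mul (hL : IsBL L) {e : L} (he : e * e = e) (x : L) : e * x = e ⊓ x := by
  refine le_antisymm (le_inf (mul_le_left _ _) (mul_le_right _ _)) ?_
  obtain ⟨z, hz⟩ := hL.exists_mul_eq (inf_le_left : e ⊓ x ≤ e)
  calc e ⊓ x = e * (e ⊓ x) := by rw [← hz, ← mul_assoc, he]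
    _ ≤ e * x := mul_le_mul_of_le le_rfl inf_le_right

theorem mul_eq_left_of_idem (hL : IsBL L) {e x y : L} (he : e * e = e) (hx : x ≤ e) (hy : e ≤ y) :
    x * y = x := by
  refine le_antisymm (mul_le_left _ _) ?_
  calc x = x * e := by rw [mul_comm, hL.idem_mul he, inf_eq_right.2 hx]
    _ ≤ x * y := mul_le_mul_of_le le_rfl hy

/-- The meet with `y ⊔ z` is a product with `y ⊔ z` by divisibility, and products distribute over
joins. -/
theorem inf_sup_le (hL : IsBL L) (x y z : L) : x ⊓ (y ⊔ z) ≤ (x ⊓ y) ⊔ (x ⊓ z) := by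
  rw [inf_comm, ← hL.div, mul_comm, mul_sup_eq, mul_comm, mul_comm _ z]
  refine sup_le_sup (le_inf ?_ (mul_le_left _ _)) (le_inf ?_ (mul_le_left _ _))
  · exact (mul_le_mul_of_le le_sup_left le_rfl).trans (mul_imp_le _ _)
  · exact (mul_le_mul_of_le le_sup_right le_rfl).trans (mul_imp_le _ _)

end IsBL

/-! ### Isomorphisms of residuated lattices -/

namespace ResIso

variable {L : Type u} {M : Type v} [ResiduatedLattice L] [ResiduatedLattice M]

theorem injective (e : ResIso L M) : Function.Injective e.toFun := e.toEquiv.injective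

theorem le_iff (e : ResIso L M) (x y : L) : e.toFun x ≤ e.toFun y ↔ x ≤ y := by
  rw [← inf_eq_left, ← e.map_inf, e.injective.eq_iff, inf_eq_left]

theorem isBL (e : ResIso L M) (h : IsBL L) : IsBL M where
  prel x y := by
    obtain ⟨x, rfl⟩ := e.toEquiv.surjective x
    obtain ⟨y, rfl⟩ := e.toEquiv.surjective y
    have := congrArg e.toFun (h.prel x y)
    rwa [e.map_sup, e.map_imp, e.map_imp, e.map_top] at this
  div x y := by
    obtain ⟨x, rfl⟩ := e.toEquiv.surjective x
    obtain ⟨y, rfl⟩ := e.toEquiv.surjective y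
    have := congrArg e.toFun (h.div x y)
    rwa [e.map_mul, e.map_imp, e.map_inf] at this

/-- The residuum is determined by order and product. -/
def ofOrderIso (e : L ≃o M) (hmul : ∀ x y, e (x * y) = e x * e y) : ResIso L M :=
  { e.toEquiv with
    map_inf := fun x y => e.map_inf x y
    map_sup := fun x y => e.map_sup x y
    map_mul := hmul
    map_imp := fun x y => by
      refine eq_of_forall_le_iff fun z => ?_
      obtain ⟨z, rfl⟩ := e.surjective z
      refine Iff.trans (e.le_iff_le (x := z) (y := x ⇝ y)) ?_
      rw [le_imp_iff, ← e.le_iff_le, hmul, le_imp_iff]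
      rfl
    map_bot := e.map_bot
    map_top := e.map_top }

theorem nonempty_of_idem (hL : IsBL L) (hM : IsBL M) (iL : ∀ x : L, x * x = x)
    (iM : ∀ x : M, x * x = x) (e : L ≃o M) : Nonempty (ResIso L M) :=
  ⟨ofOrderIso e fun x y => by rw [hL.idem_mul (iL x), hM.idem_mul (iM _), e.map_inf]⟩

end ResIso

/-- `φ` numbers the elements of the chain `L` increasingly by `0, …, k`. -/
structure IsRanking {L : Type u} [ResiduatedLattice L] (φ : L → ℕ) (k : ℕ) : Prop where
  le_iff : ∀ x y, x ≤ y ↔ φ x ≤ φ y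
  exists_iff : ∀ i, (∃ x, φ x = i) ↔ i ≤ k

/-! ### Finite BL-chains and their idempotents -/

namespace IsRanking

variable {L : Type u} {M : Type v} [ResiduatedLattice L] [ResiduatedLattice M]
  {φ : L → ℕ} {ψ : M → ℕ} {k : ℕ}

theorem le (h : IsRanking φ k) (x : L) : φ x ≤ k := (h.exists_iff _).1 ⟨x, rfl⟩

theorem injective (h : IsRanking φ k) : Function.Injective φ := fun x y e =>
  le_antisymm ((h.le_iff x y).2 e.le) ((h.le_iff y x).2 e.ge)

theorem lt_iff (h : IsRanking φ k) (x y : L) : x < y ↔ φ x < φ y := by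
  rw [lt_iff_le_not_ge, h.le_iff, h.le_iff, lt_iff_le_not_ge]

theorem isChainAlg (h : IsRanking φ k) : IsChainAlg L := fun x y => by
  rw [h.le_iff, h.le_iff]
  exact le_total _ _

theorem bot (h : IsRanking φ k) : φ ⊥ = 0 := by
  obtain ⟨x, hx⟩ := (h.exists_iff 0).2 (Nat.zero_le k)
  have := (h.le_iff ⊥ x).1 bot_le
  omega

theorem top (h : IsRanking φ k) : φ ⊤ = k := by
  obtain ⟨x, hx⟩ := (h.exists_iff k).2 le_rfl
  have := (h.le_iff x ⊤).1 le_top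
  have := h.le ⊤
  omega

theorem natCard (h : IsRanking φ k) : Nat.card L = k + 1 := by
  rw [← Nat.card_range_of_injective h.injective,
    show Set.range φ = ((Finset.range (k + 1) : Finset ℕ) : Set ℕ) by
      ext i; simp [h.exists_iff]]
  simp

theorem comp (h : IsRanking φ k) (e : ResIso M L) : IsRanking (φ ∘ e.toFun) k where
  le_iff x y := by
    rw [← e.le_iff, h.le_iff]
    rfl
  exists_iff i := by
    rw [← h.exists_iff]
    constructor
    · rintro ⟨x, rfl⟩
      exact ⟨_, rfl⟩
    · rintro ⟨y, rfl⟩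
      obtain ⟨x, rfl⟩ := e.toEquiv.surjective y
      exact ⟨x, rfl⟩

theorem unique {φ' : L → ℕ} {k' : ℕ} (h : IsRanking φ k) (h' : IsRanking φ' k') : φ = φ' := by
  have key : ∀ n x, φ x = n → φ' x = n := by
    intro n
    induction n using Nat.strong_induction_on with
    | _ n ih =>
      intro x hx
      rcases lt_trichotomy (φ' x) n with hlt | heq | hgt
      · obtain ⟨y, hy⟩ := (h.exists_iff (φ' x)).2 (by have := h.le x; omega)
        have := h'.injective (ih _ hlt y hy)
        subst this
        omega
      · exact heq
      · obtain ⟨y, hy⟩ := (h'.exists_iff n).2 (by have := h'.le x; omega)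
        have hyx : φ y < n := by
          rw [← hx, ← h.lt_iff, h'.lt_iff]
          omega
        have := ih _ hyx y rfl
        omega
  funext x
  exact (key _ x rfl).symm

theorem exists_of_isChainAlg [Finite L] (h : IsChainAlg L) (hk : Nat.card L = k + 1) :
    ∃ φ : L → ℕ, IsRanking φ k := by
  classical
  have := Fintype.ofFinite L
  let iL : LinearOrder L :=
    { (inferInstance : PartialOrder L) with
      min := fun a b => if a ≤ b then a else b
      max := fun a b => if a ≤ b then b else a
      le_total := h
      toDecidableLE := Classical.decRel _ }
  let e : Fin (k + 1) ≃o L :=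
    @Fintype.orderIsoFinOfCardEq L iL _ _ (by rw [← Nat.card_eq_fintype_card, hk])
  refine ⟨fun x => (e.symm x : ℕ), fun x y => ?_, fun i => ⟨?_, fun hi => ?_⟩⟩
  · rw [← Fin.le_def]
    exact (e.symm.le_iff_le (x := x) (y := y)).symm
  · rintro ⟨x, rfl⟩
    exact Nat.lt_succ_iff.1 (e.symm x).2
  · exact ⟨e ⟨i, Nat.lt_succ_iff.2 hi⟩, by simp⟩

/-- The order isomorphism between two chains of the same length. -/
theorem exists_orderIso (h : IsRanking φ k) (h' : IsRanking ψ k) :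
    ∃ e : L ≃o M, ∀ x, ψ (e x) = φ x := by
  have h1 : ∀ x, ∃ y, ψ y = φ x := fun x => (h'.exists_iff _).2 (h.le x)
  choose f hf using h1
  have hinj : Function.Injective f := fun x y e => h.injective (by rw [← hf, ← hf, e])
  have hsurj : Function.Surjective f := fun y => by
    obtain ⟨x, hx⟩ := (h.exists_iff (ψ y)).2 (h'.le y)
    exact ⟨x, h'.injective (by rw [hf, hx])⟩
  refine ⟨⟨Equiv.ofBijective f ⟨hinj, hsurj⟩, ?_⟩, hf⟩
  intro x y
  change f x ≤ f y ↔ x ≤ y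
  rw [h'.le_iff, hf, hf, h.le_iff]

/-- `i` is the number of an idempotent. -/
def Idem {L : Type u} [ResiduatedLattice L] (φ : L → ℕ) (i : ℕ) : Prop :=
  ∃ x, x * x = x ∧ φ x = i

theorem idem_zero (h : IsRanking φ k) : Idem φ 0 := ⟨⊥, mul_bot _, h.bot⟩

theorem idem_last (h : IsRanking φ k) : Idem φ k := ⟨⊤, mul_top _, h.top⟩

/-- An element `w` skipped between `x * y` and `x * z` would lie below `x`, hence be `x * t`; but `t
≤ y` or `z ≤ t`, and monotonicity excludes both. -/
theorem rank_mul_succ_le (h : IsRanking φ k) (hL : IsBL L) {x y z : L} (hz : φ z = φ y + 1) :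
    φ (x * z) ≤ φ (x * y) + 1 := by
  by_contra hlt
  obtain ⟨w, hw⟩ := (h.exists_iff (φ (x * y) + 1)).2 (by have := h.le (x * z); omega)
  have hwx : w ≤ x := by
    have := (h.le_iff _ _).1 (mul_le_left x z)
    rw [h.le_iff]
    omega
  obtain ⟨t, rfl⟩ := hL.exists_mul_eq hwx
  rcases le_or_gt (φ t) (φ y) with hty | hty
  · have := (h.le_iff _ _).1 (mul_le_mul_of_le (le_refl x) ((h.le_iff _ _).2 hty))
    omega
  · have := (h.le_iff _ _).1 (mul_le_mul_of_le (le_refl x) ((h.le_iff z t).2 (by omega)))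
    omega

/-- The least `z` with `x * z = x` is idempotent, because `z * z` fixes `x` too. It satisfies `a < x
≤ z ≤ d < b`, and no idempotent lies there. -/
theorem mul_ne_self (h : IsRanking φ k) {a b x d : L}
    (hab : ∀ c, c * c = c → a < c → c < b → False) (hx : a < x) (hd : d < b) : x * d ≠ x := by
  intro hxd
  have hP : ∃ i, ∃ z, x * z = x ∧ φ z = i := ⟨_, d, hxd, rfl⟩
  classical
  obtain ⟨z, hz, hzi⟩ := Nat.find_spec hP
  have hzmin : ∀ t, x * t = x → z ≤ t := fun t ht =>
    (h.le_iff _ _).2 (hzi ▸ Nat.find_min' hP ⟨t, ht, rfl⟩)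
  have hzz : z * z = z := le_antisymm (mul_le_left _ _) (hzmin _ (by rw [← mul_assoc, hz, hz]))
  refine hab z hzz ?_ ((hzmin d hxd).trans_lt hd)
  exact hx.trans_le (hz ▸ mul_le_right x z)

/-- The product between two neighbouring idempotents. -/
theorem rank_mul_between (h : IsRanking φ k) (hL : IsBL L) {a b : L} (ha : a * a = a)
    (hb : b * b = b) (hab : ∀ c, c * c = c → a < c → c < b → False) :
    ∀ (n : ℕ) (x y : L), φ y + n = φ b → a ≤ x → x ≤ b → a ≤ y →
      φ (x * y) = max (φ a) (φ x - n) := by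
  intro n
  induction n with
  | zero =>
    intro x y hy hax hxb hay
    rw [h.injective (a₁ := y) (a₂ := b) (by omega), hL.mul_eq_left_of_idem hb hxb le_rfl]
    have := (h.le_iff _ _).1 hax
    omega
  | succ n ih =>
    intro x y hy hax hxb hay
    have hya := (h.le_iff _ _).1 hay
    obtain ⟨y', hy'⟩ := (h.exists_iff (φ y + 1)).2 (by have := h.le b; omega)
    obtain ⟨d, hd⟩ := (h.exists_iff (φ b - 1)).2 (by have := h.le b; omega)
    have hdb : d < b := (h.lt_iff _ _).2 (by omega)
    have had : a ≤ d := (h.le_iff _ _).2 (by omega)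
    -- Multiplication by the predecessor `d` of `b` lowers the rank by exactly one until `a` is
    -- reached: `rank_mul_succ_le` bounds the drop and `mul_ne_self` forces it.
    have key : ∀ z, a ≤ z → z ≤ b → φ (z * d) = max (φ a) (φ z - 1) := by
      intro z haz hzb
      rcases haz.eq_or_lt with rfl | hlt
      · rw [hL.mul_eq_left_of_idem ha le_rfl had]
        omega
      · have h1 := h.rank_mul_succ_le hL (x := z) (y := d) (z := b) (by omega)
        rw [hL.mul_eq_left_of_idem hb hzb le_rfl] at h1
        have h2 := (h.le_iff _ _).1 (mul_le_left z d)
        have h3 : φ (z * d) ≠ φ z := fun e => h.mul_ne_self hab hlt hdb (h.injective e)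
        have := (h.lt_iff _ _).1 hlt
        omega
    have hay' : a ≤ y' := (h.le_iff _ _).2 (by omega)
    have hyb' : y' ≤ b := (h.le_iff _ _).2 (by omega)
    -- So `y` arises from its successor `y'` by one more factor `d`, which drives the induction on
    -- the distance to `b`.
    have e1 : y = y' * d := h.injective (by rw [key y' hay' hyb']; omega)
    have e2 := ih x y' (by omega) hax hxb hay'
    have e3 : a ≤ x * y' := idem_mul_of_le ha hax hay'
    rw [e1, ← mul_assoc, key _ e3 ((mul_le_left _ _).trans hxb), e2]
    omega

/-- A finite BL-chain is determined by its length and the places of its idempotents. -/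
theorem nonempty_resIso (h : IsRanking φ k) (h' : IsRanking ψ k) (hL : IsBL L) (hM : IsBL M)
    (hi : ∀ i, Idem φ i ↔ Idem ψ i) : Nonempty (ResIso L M) := by
  classical
  obtain ⟨e, he⟩ := h.exists_orderIso h'
  have hei : ∀ x, x * x = x ↔ e x * e x = e x := by
    intro x
    constructor
    · intro hx
      obtain ⟨y, hy, hyx⟩ := (hi _).1 ⟨x, hx, rfl⟩
      rwa [← h'.injective (hyx.trans (he x).symm)]
    · intro hx
      obtain ⟨y, hy, hyx⟩ := (hi _).2 ⟨e x, hx, rfl⟩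
      rwa [← h.injective (hyx.trans (he x))]
  refine ⟨ResIso.ofOrderIso e fun x y => h'.injective ?_⟩
  rw [he]
  -- `b` is the least idempotent above `x` and `a` the greatest below; the latter is found by
  -- minimizing `k - φ a`. Outside `[a, b]` the element `y` is separated from `x` by an idempotent.
  have hbP : ∃ i, ∃ b, b * b = b ∧ x ≤ b ∧ φ b = i := ⟨_, ⊤, mul_top _, le_top, rfl⟩
  obtain ⟨b, hb, hxb, hbi⟩ := Nat.find_spec hbP
  have hbmin : ∀ c, c * c = c → x ≤ c → b ≤ c := fun c hc hxc =>
    (h.le_iff _ _).2 (hbi ▸ Nat.find_min' hbP ⟨c, hc, hxc, rfl⟩)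
  have haP : ∃ i, ∃ a, a * a = a ∧ a ≤ x ∧ k - φ a = i := ⟨_, ⊥, mul_bot _, bot_le, rfl⟩
  obtain ⟨a, ha, hax, hai⟩ := Nat.find_spec haP
  have hamax : ∀ c, c * c = c → c ≤ x → c ≤ a := fun c hc hcx => by
    have := Nat.find_min' haP ⟨c, hc, hcx, rfl⟩
    have := h.le c
    have := h.le a
    rw [h.le_iff]
    omega
  rcases h.isChainAlg b y with hby | hyb
  · rw [hL.mul_eq_left_of_idem hb hxb hby, hM.mul_eq_left_of_idem ((hei b).1 hb)
      (e.monotone hxb) (e.monotone hby), he]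
  rcases h.isChainAlg y a with hya | hay
  · rw [mul_comm x, mul_comm (e x), hL.mul_eq_left_of_idem ha hya hax,
      hM.mul_eq_left_of_idem ((hei a).1 ha) (e.monotone hya) (e.monotone hax), he]
  have hab : ∀ c, c * c = c → a < c → c < b → False := fun c hc hac hcb => by
    rcases h.isChainAlg c x with hcx | hxc
    · exact hac.not_ge (hamax c hc hcx)
    · exact hcb.not_ge (hbmin c hc hxc)
  have hab' : ∀ c, c * c = c → e a < c → c < e b → False := fun c hc hac hcb => by
    obtain ⟨c, rfl⟩ := e.surjective c
    exact hab c ((hei c).2 hc) (e.lt_iff_lt.1 hac) (e.lt_iff_lt.1 hcb)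
  have hn : φ y + (φ b - φ y) = φ b := by
    have := (h.le_iff _ _).1 hyb
    omega
  rw [h.rank_mul_between hL ha hb hab _ x y hn hax hxb hay,
    h'.rank_mul_between hM ((hei a).1 ha) ((hei b).1 hb) hab' (φ b - φ y) (e x) (e y)
      (by rw [he, he, hn]) (e.monotone hax) (e.monotone hxb) (e.monotone hay), he, he]

end IsRanking

/-! ### Ordinal products of BL-algebras and of ranked chains -/

namespace OrdProd

variable {A : Type u} {B : Type v} [ResiduatedLattice A] [ResiduatedLattice B]

theorem lo_le_lo_iff {x y : A} (hx : x ≠ ⊤) (hy : y ≠ ⊤) :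
    (lo x hx : OrdProd A B) ≤ lo y hy ↔ x ≤ y := Iff.rfl

theorem lo_le_hi {x : A} (hx : x ≠ ⊤) (y : B) : lo x hx ≤ hi y := trivial

theorem not_hi_le_lo (x : B) {y : A} (hy : y ≠ ⊤) : ¬ hi x ≤ lo y hy := id

theorem hi_le_hi_iff {x y : B} : (hi x : OrdProd A B) ≤ hi y ↔ x ≤ y := Iff.rfl

theorem lo_mul_lo {x y : A} (hx : x ≠ ⊤) (hy : y ≠ ⊤) :
    (lo x hx * lo y hy : OrdProd A B) = lo (x * y) (rmul_ne_top x y hx) :=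
  inl_of_ne _ (rmul_ne_top x y hx)

theorem hi_mul_hi (x y : B) : (hi x * hi y : OrdProd A B) = hi (x * y) := rfl

theorem hi_mul_lo (x : B) {y : A} (hy : y ≠ ⊤) : (hi x * lo y hy : OrdProd A B) = lo y hy := rfl

/-- Totality of `A` is needed for prelinearity: for incomparable `x, y` in `A` the join of the two
residua would reach at most `1_A = 0_B`. -/
theorem isBL (hA : IsBL A) (hc : IsChainAlg A) (hB : IsBL B) : IsBL (OrdProd A B) where
  prel := by
    have key : ∀ a b : OrdProd A B, a ≤ b ∨ b ≤ a → (a ⇝ b) ⊔ (b ⇝ a) = ⊤ := by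
      rintro a b (h | h)
      · rw [imp_eq_top.2 h, top_sup_eq]
      · rw [imp_eq_top.2 h, sup_top_eq]
    rintro (⟨x, hx⟩ | x) (⟨y, hy⟩ | y)
    · exact key _ _ (hc x y)
    · exact key _ _ (Or.inl (lo_le_hi hx y))
    · exact key _ _ (Or.inr (lo_le_hi hy x))
    · exact congrArg hi (hB.prel x y)
  div := by
    have key : ∀ a b : OrdProd A B, (∃ c, a * c = a ⊓ b) → a * (a ⇝ b) = a ⊓ b := by
      rintro a b ⟨c, hc⟩
      refine le_antisymm (le_inf (mul_le_left _ _) (mul_imp_le _ _)) ?_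
      rw [← hc]
      refine mul_le_mul_of_le le_rfl ((le_imp_iff _ _ _).2 ?_)
      rw [hc]
      exact inf_le_right
    rintro (⟨x, hx⟩ | x) (⟨y, hy⟩ | y)
    · apply key
      rcases hc x y with h | h
      · exact ⟨⊤, by rw [mul_top, inf_eq_left.2 ((lo_le_lo_iff hx hy).2 h)]⟩
      · rw [inf_eq_right.2 ((lo_le_lo_iff hy hx).2 h)]
        obtain ⟨z, hz⟩ := hA.exists_mul_eq h
        -- The top of `A` is not represented by `lo`; in that case `y = x`, and the top of the
        -- ordinal product serves as cofactor.
        by_cases hzt : z = ⊤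
        · refine ⟨⊤, ?_⟩
          rw [mul_top]
          congr 1
          rw [← hz, hzt, mul_top]
        · refine ⟨lo z hzt, ?_⟩
          rw [lo_mul_lo]
          congr 1
    · exact key _ _ ⟨⊤, by rw [mul_top, inf_eq_left.2 (lo_le_hi hx y)]⟩
    · exact key _ _ ⟨lo y hy, by rw [hi_mul_lo, inf_eq_right.2 (lo_le_hi hy x)]⟩
    · exact congrArg hi (hB.div x y)

/-- The elements of the ordinal product. -/
def equivSum (A : Type u) (B : Type v) [ResiduatedLattice A] :
    OrdProd A B ≃ {x : A // x ≠ ⊤} ⊕ B where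
  toFun
    | lo x hx => Sum.inl ⟨x, hx⟩
    | hi y => Sum.inr y
  invFun := Sum.elim (fun x => lo x.1 x.2) hi
  left_inv := by rintro (⟨x, hx⟩ | x) <;> rfl
  right_inv := by rintro (⟨x, hx⟩ | x) <;> rfl

theorem natCard (A : Type u) (B : Type v) [ResiduatedLattice A] [Finite A] [Finite B] :
    Nat.card (OrdProd A B) + 1 = Nat.card A + Nat.card B := by
  classical
  have := Fintype.ofFinite A
  have := Fintype.ofFinite B
  have h : 0 < Fintype.card A := Fintype.card_pos_iff.2 ⟨⊤⟩
  rw [Nat.card_congr (equivSum A B), Nat.card_sum, Nat.card_eq_fintype_card,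
    Nat.card_eq_fintype_card, Nat.card_eq_fintype_card]
  have := Fintype.card_subtype_compl (fun x : A => x = ⊤)
  rw [Fintype.card_subtype_eq] at this
  simp only [ne_eq]
  omega

/-- The numbering of the ordinal product of two chains. -/
def rank (φ : A → ℕ) (ψ : B → ℕ) (a : ℕ) : OrdProd A B → ℕ
  | lo x _ => φ x
  | hi y => a + ψ y

theorem isRanking_rank {φ : A → ℕ} {ψ : B → ℕ} {a b : ℕ} (hφ : IsRanking φ a)
    (hψ : IsRanking ψ b) : IsRanking (rank φ ψ a) (a + b) where
  le_iff := by
    rintro (⟨x, hx⟩ | x) (⟨y, hy⟩ | y)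
    · rw [lo_le_lo_iff]
      exact hφ.le_iff x y
    · have := hφ.le x
      simp only [lo_le_hi, rank, true_iff]
      omega
    · have := hφ.top ▸ (hφ.lt_iff _ _).1 (lt_top_iff_ne_top.2 hy)
      simp only [not_hi_le_lo, rank, false_iff]
      omega
    · rw [hi_le_hi_iff, hψ.le_iff]
      simp [rank]
  exists_iff i := by
    constructor
    · rintro ⟨⟨x, hx⟩ | y, rfl⟩
      · have := hφ.le x
        simp only [rank]
        omega
      · have := hψ.le y
        simp only [rank]
        omega
    · intro hi'
      rcases lt_or_ge i a with h | h
      · obtain ⟨x, rfl⟩ := (hφ.exists_iff i).2 h.le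
        refine ⟨lo x ?_, rfl⟩
        rintro rfl
        exact h.ne hφ.top
      · obtain ⟨y, hy⟩ := (hψ.exists_iff (i - a)).2 (by omega)
        refine ⟨hi y, ?_⟩
        simp only [rank]
        omega

/-- The place `a` is assigned to the upper factor, since `1_A` is represented by the bottom of `B`.
-/
theorem idem_rank {φ : A → ℕ} {ψ : B → ℕ} {a : ℕ} (hφ : IsRanking φ a)
    (i : ℕ) : IsRanking.Idem (rank φ ψ a : OrdProd A B → ℕ) i ↔
      (i < a ∧ IsRanking.Idem φ i) ∨ (a ≤ i ∧ IsRanking.Idem ψ (i - a)) := by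
  constructor
  · rintro ⟨⟨x, hx⟩ | y, he, rfl⟩
    · left
      rw [lo_mul_lo] at he
      exact ⟨hφ.top ▸ (hφ.lt_iff _ _).1 (lt_top_iff_ne_top.2 hx), x, by injection he, rfl⟩
    · right
      rw [hi_mul_hi] at he
      exact ⟨Nat.le_add_right _ _, y, by injection he, by simp [rank]⟩
  · rintro (⟨h, x, hx, rfl⟩ | ⟨h, y, hy, hi'⟩)
    · refine ⟨lo x ?_, ?_, rfl⟩
      · rintro rfl
        exact h.ne hφ.top
      · rw [lo_mul_lo]
        congr 1
    · refine ⟨hi y, congrArg hi hy, ?_⟩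
      simp only [rank]
      omega

end OrdProd

/-! ### The chain of ideals of `ℤ/2ᵏ` -/

section IdealsZMod

/-- The ideal of `ℤ/2ᵏ` generated by `2ⁱ`. -/
def twoPowIdeal (k i : ℕ) : Ideal (ZMod (2 ^ k)) := Ideal.span {(2 : ZMod (2 ^ k)) ^ i}

/-- The preimage of `I` in `ℤ` is principal and contains `2ᵏ`, so its generator is a power of `2` up
to sign. -/
theorem exists_twoPowIdeal_eq (k : ℕ) (I : Ideal (ZMod (2 ^ k))) :
    ∃ i ≤ k, I = twoPowIdeal k i := by
  have hsurj : Function.Surjective (Int.castRingHom (ZMod (2 ^ k))) := ZMod.intCast_surjective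
  obtain ⟨d, hd⟩ := (IsPrincipalIdealRing.principal (I.comap (Int.castRingHom _))).principal
  have hmem : (2 : ℤ) ^ k ∈ I.comap (Int.castRingHom (ZMod (2 ^ k))) := by
    rw [Ideal.mem_comap]
    have h0 : ((2 ^ k : ℕ) : ZMod (2 ^ k)) = 0 := ZMod.natCast_self _
    have : Int.castRingHom (ZMod (2 ^ k)) (2 ^ k) = 0 := by
      rw [Nat.cast_pow, Nat.cast_ofNat] at h0
      rw [map_pow, map_ofNat, h0]
    rw [this]
    exact I.zero_mem
  rw [hd] at hmem
  obtain ⟨i, hi, hdi⟩ := (dvd_prime_pow Int.prime_two k).1 (Ideal.mem_span_singleton.1 hmem)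
  refine ⟨i, hi, ?_⟩
  rw [← Ideal.map_comap_of_surjective _ hsurj I, hd]
  change Ideal.map _ (Ideal.span {d}) = _
  rw [Ideal.span_singleton_eq_span_singleton.2 hdi, Ideal.map_span, twoPowIdeal]
  simp

theorem twoPowIdeal_mul (k i j : ℕ) :
    twoPowIdeal k i * twoPowIdeal k j = twoPowIdeal k (i + j) := by
  rw [twoPowIdeal, twoPowIdeal, twoPowIdeal, Ideal.span_singleton_mul_span_singleton, pow_add]

theorem twoPowIdeal_antitone (k : ℕ) {i j : ℕ} (h : i ≤ j) : twoPowIdeal k j ≤ twoPowIdeal k i :=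
  Ideal.span_singleton_le_span_singleton.2 (pow_dvd_pow _ h)

/-- For `j < k` the inclusion would make `2 ^ (j + 1)` divide `2 ^ j`. This yields both the
strictness of the chain and the absence of interior idempotents. -/
theorem le_of_twoPowIdeal_le {k i j : ℕ} (hij : j < i) (h : twoPowIdeal k j ≤ twoPowIdeal k i) :
    k ≤ j := by
  by_contra! hk
  obtain ⟨c, hc⟩ := Ideal.span_singleton_le_span_singleton.1 h
  obtain ⟨n, rfl⟩ := ZMod.natCast_zmod_surjective c
  have hm : 2 ^ j ≡ 2 ^ i * n [MOD 2 ^ k] := by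
    rw [← ZMod.natCast_eq_natCast_iff]
    simpa using hc
  have := (hm.dvd_iff (pow_dvd_pow 2 hk)).2 ((pow_dvd_pow 2 hij).mul_right n)
  have := (Nat.pow_dvd_pow_iff_le_right (by norm_num)).1 this
  omega

theorem twoPowIdeal_le_iff {k i j : ℕ} (hi : i ≤ k) :
    twoPowIdeal k j ≤ twoPowIdeal k i ↔ i ≤ j := by
  refine ⟨fun h => ?_, twoPowIdeal_antitone k⟩
  by_contra! hlt
  have := le_of_twoPowIdeal_le hlt h
  omega

theorem isChainAlg_ideal_zmod (k : ℕ) : IsChainAlg (Ideal (ZMod (2 ^ k))) := by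
  intro I J
  obtain ⟨i, -, rfl⟩ := exists_twoPowIdeal_eq k I
  obtain ⟨j, -, rfl⟩ := exists_twoPowIdeal_eq k J
  exact (le_total j i).imp (twoPowIdeal_antitone k) (twoPowIdeal_antitone k)

theorem isBL_ideal_zmod (k : ℕ) : IsBL (Ideal (ZMod (2 ^ k))) := by
  refine IsBL.of_isChainAlg (isChainAlg_ideal_zmod k) fun I J h => ?_
  obtain ⟨i, hi, rfl⟩ := exists_twoPowIdeal_eq k I
  obtain ⟨j, -, rfl⟩ := exists_twoPowIdeal_eq k J
  refine ⟨twoPowIdeal k (j - i), ?_⟩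
  rw [twoPowIdeal_mul, Nat.add_sub_cancel' ((twoPowIdeal_le_iff hi).1 h)]

theorem exists_isRanking_ideal_zmod (k : ℕ) :
    ∃ φ : Ideal (ZMod (2 ^ k)) → ℕ, IsRanking φ k ∧
      ∀ i, IsRanking.Idem φ i ↔ i = 0 ∨ i = k := by
  choose f hf hfe using exists_twoPowIdeal_eq k
  have hfi : ∀ i ≤ k, f (twoPowIdeal k i) = i := fun i hi =>
    le_antisymm ((twoPowIdeal_le_iff (hf _)).1 (hfe (twoPowIdeal k i)).le)
      ((twoPowIdeal_le_iff hi).1 (hfe (twoPowIdeal k i)).ge)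
  -- Larger exponents give smaller ideals, so the exponent is subtracted from `k`.
  have hr : IsRanking (fun I => k - f I) k :=
    { le_iff := fun I J => by
        have h1 := hf I
        have h2 := hf J
        conv_lhs => rw [hfe I, hfe J, twoPowIdeal_le_iff h2]
        omega
      exists_iff := fun i => by
        constructor
        · rintro ⟨I, rfl⟩
          exact Nat.sub_le _ _
        · intro hi
          refine ⟨twoPowIdeal k (k - i), ?_⟩
          simp only [hfi _ (Nat.sub_le k i)]
          omega }
  refine ⟨_, hr, fun i => ⟨?_, ?_⟩⟩
  · rintro ⟨I, hI, rfl⟩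
    have h1 := hf I
    rw [hfe I, twoPowIdeal_mul] at hI
    have h2 : f I ≠ 0 → k ≤ f I := fun h0 => le_of_twoPowIdeal_le (by omega) hI.ge
    simp only
    omega
  · rintro (rfl | rfl)
    · exact hr.idem_zero
    · exact hr.idem_last

end IdealsZMod

/-! ### The four ideals of `ℤ/2 × ℤ/2` -/

section IdealsProduct

/-- If `J` is a complement of `I`, then `IJ = 0` and `I = I(I + J) = I²`. The complement of `I` lies
in every `I → K`, and `I` lies in `K → I`, which gives prelinearity; idempotence gives divisibility.
-/
theorem isBL_ideal_of_complementedLattice (R : Type u) [CommRing R]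
    [ComplementedLattice (Ideal R)] : IsBL (Ideal R) ∧ ∀ I : Ideal R, I * I = I := by
  have hi : ∀ I : Ideal R, I * I = I := fun I => by
    obtain ⟨J, hJ⟩ := exists_isCompl I
    calc I * I = I * I ⊔ I * J := by
          rw [sup_eq_left.2]
          exact (Ideal.mul_le_inf.trans hJ.inf_eq_bot.le).trans bot_le
      _ = I := by rw [← mul_sup_eq, hJ.sup_eq_top, mul_top]
  refine ⟨⟨fun I J => ?_, fun I J => ?_⟩, hi⟩
  · obtain ⟨C, hC⟩ := exists_isCompl I
    rw [← top_le_iff, ← hC.sup_eq_top]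
    refine sup_le ((le_imp_self J I).trans le_sup_right) (le_trans ?_ le_sup_left)
    rw [le_imp_iff]
    exact (Ideal.mul_le_inf.trans hC.inf_eq_bot.le).trans bot_le
  · refine le_antisymm (le_inf (mul_le_left _ _) (mul_imp_le _ _)) ?_
    rw [← hi (I ⊓ J)]
    exact mul_le_mul_of_le inf_le_left (inf_le_right.trans (le_imp_self I J))

theorem isBL_ideal_zmod_prod : IsBL (Ideal (ZMod 2 × ZMod 2)) :=
  haveI : ComplementedLattice (Ideal (ZMod 2 × ZMod 2)) :=
    (inferInstance : ComplementedLattice (Submodule (ZMod 2 × ZMod 2) (ZMod 2 × ZMod 2)))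
  (isBL_ideal_of_complementedLattice _).1

theorem natCard_ideal_field (K : Type u) [Field K] : Nat.card (Ideal K) = 2 := by
  classical
  rw [Nat.card_congr IsSimpleOrder.equivBool, Nat.card_eq_fintype_card, Fintype.card_bool]

theorem natCard_ideal_zmod_prod : Nat.card (Ideal (ZMod 2 × ZMod 2)) = 4 := by
  rw [Nat.card_congr Ideal.idealProdEquiv.toEquiv, Nat.card_prod, natCard_ideal_field]

theorem not_isChainAlg_ideal_zmod_prod : ¬ IsChainAlg (Ideal (ZMod 2 × ZMod 2)) := by
  intro h
  rcases h (Ideal.idealProdEquiv.symm (⊤, ⊥)) (Ideal.idealProdEquiv.symm (⊥, ⊤)) with h | h <;>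
  · rw [OrderIso.le_iff_le, Prod.mk_le_mk] at h
    simp at h

end IdealsProduct

/-- Without an interior place in `S`, the algebra `Id(ℤ/2ᵏ)` serves; otherwise `S` is cut at such a
place `r` and models of lengths `r` and `k - r` are glued. The final clause keeps this splitting for
the decomposition of non-MV chains. -/
theorem exists_chain_model (k : ℕ) : 1 ≤ k → ∀ S : Set ℕ, 0 ∈ S → k ∈ S → (∀ i ∈ S, i ≤ k) →
    ∃ (A : Type) (iA : ResiduatedLattice A), BuiltFromIdeals A iA ∧ IsBL A ∧
      (∃ φ : A → ℕ, IsRanking φ k ∧ ∀ i, IsRanking.Idem φ i ↔ i ∈ S) ∧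
      ((∃ r ∈ S, 0 < r ∧ r < k) → ∃ (B C : Type) (iB : ResiduatedLattice B)
        (iC : ResiduatedLattice C), BuiltFromIdeals B iB ∧ BuiltFromIdeals C iC ∧ IsBL B ∧
        IsBL C ∧ IsChainAlg B ∧ Nontrivial B ∧ Nontrivial C ∧
        Nonempty (ResIso A (OrdProd B C))) := by
  induction k using Nat.strong_induction_on with
  | _ k ih =>
  intro hk S h0 hkS hS
  by_cases hr : ∃ r ∈ S, 0 < r ∧ r < k
  · obtain ⟨r, hrS, hr0, hrk⟩ := hr
    obtain ⟨B, iB, bB, blB, ⟨φ, hφ, hφS⟩, -⟩ := ih r hrk hr0 (S ∩ {i | i ≤ r}) ⟨h0, hr0.le⟩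
      ⟨hrS, le_refl r⟩ fun i hi => hi.2
    obtain ⟨C, iC, bC, blC, ⟨ψ, hψ, hψS⟩, -⟩ := ih (k - r) (by omega) (by omega) {i | r + i ∈ S}
      hrS (by simpa [Nat.add_sub_cancel' hrk.le] using hkS) fun i hi => by
        have := hS _ hi
        omega
    have nt : ∀ (D : Type) [ResiduatedLattice D] (χ : D → ℕ) (d : ℕ), IsRanking χ d → 0 < d →
        Nontrivial D := fun D _ χ d hχ hd => by
      refine ⟨⟨⊥, ⊤, fun e => ?_⟩⟩
      have := hχ.bot
      rw [e, hχ.top] at this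
      omega
    refine ⟨OrdProd B C, OrdProd.residuatedLattice, .ordProd B C iB iC bB bC hφ.isChainAlg,
      OrdProd.isBL blB hφ.isChainAlg blC, ⟨OrdProd.rank φ ψ r, ?_, fun i => ?_⟩, fun _ =>
      ⟨B, C, iB, iC, bB, bC, blB, blC, hφ.isChainAlg, nt B φ r hφ hr0, nt C ψ _ hψ (by omega),
        ⟨ResIso.refl _⟩⟩⟩
    · have := OrdProd.isRanking_rank hφ hψ
      rwa [Nat.add_sub_cancel' hrk.le] at this
    · rw [OrdProd.idem_rank hφ, hφS, hψS]
      simp only [Set.mem_inter_iff, Set.mem_ofPred_eq]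
      constructor
      · rintro (⟨-, h, -⟩ | ⟨hri, h⟩)
        · exact h
        · rwa [Nat.add_sub_cancel' hri] at h
      · intro h
        rcases lt_or_ge i r with hir | hir
        · exact Or.inl ⟨hir, h, hir.le⟩
        · exact Or.inr ⟨hir, by rwa [Nat.add_sub_cancel' hir]⟩
  · obtain ⟨φ, hφ, hφi⟩ := exists_isRanking_ideal_zmod k
    refine ⟨_, _, .zmod k hk, isBL_ideal_zmod k, ⟨φ, hφ, fun i => ?_⟩, fun h => absurd h hr⟩
    rw [hφi]
    constructor
    · rintro (rfl | rfl) <;> assumption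
    · intro hi
      by_contra! h
      exact hr ⟨i, hi, by omega, by have := hS i hi; omega⟩

/-! ### BL-algebras with at most five elements that are not chains -/

section NonChain

variable {L : Type u} [ResiduatedLattice L]

/-- Two elements and their meet and join span a copy of the square. -/
theorem exists_orderEmbedding_square {p q : L} (hpq : p ⊔ q = ⊤) (hp : p ≠ ⊤) (hq : q ≠ ⊤) :
    ∃ f : Bool × Bool ↪o L, f (false, false) = p ⊓ q ∧ f (true, false) = p ∧
      f (false, true) = q ∧ f (true, true) = ⊤ := by
  have h1 : ¬ p ≤ q := fun h => hq (by rwa [sup_eq_right.2 h] at hpq)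
  have h2 : ¬ q ≤ p := fun h => hp (by rwa [sup_eq_left.2 h] at hpq)
  refine ⟨OrderEmbedding.ofMapLEIff
    (fun | (false, false) => p ⊓ q | (true, false) => p | (false, true) => q | (true, true) => ⊤)
    ?_, rfl, rfl, rfl, rfl⟩
  rintro ⟨_ | _, _ | _⟩ ⟨_ | _, _ | _⟩ <;> simp [h1, h2, hp, hq]

/-- By distributivity `x ↦ (x ⊔ p, x ⊔ q)` is a bijection onto the product of the two up-sets, with
the meet as inverse. -/
theorem natCard_eq_mul_of_isCompl [Finite L] (hL : IsBL L) {p q : L} (h : IsCompl p q) :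
    Nat.card L = Nat.card (Set.Ici p) * Nat.card (Set.Ici q) := by
  let d : DistribLattice L := DistribLattice.ofInfSupLe hL.inf_sup_le
  have hsup : ∀ x y z : L, (x ⊓ y) ⊔ z = (x ⊔ z) ⊓ (y ⊔ z) := fun x y z => sup_inf_right (α := L) x y z
  have hsup' : ∀ x y z : L, x ⊔ (y ⊓ z) = (x ⊔ y) ⊓ (x ⊔ z) := fun x y z => sup_inf_left (α := L) x y z
  rw [← Nat.card_prod]
  refine Nat.card_congr ⟨fun x => (⟨x ⊔ p, le_sup_right⟩, ⟨x ⊔ q, le_sup_right⟩),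
    fun y => y.1.1 ⊓ y.2.1, fun x => ?_, ?_⟩
  · simp only
    rw [← hsup', h.inf_eq_bot, sup_bot_eq]
  · rintro ⟨⟨a, ha⟩, ⟨b, hb⟩⟩
    have h1 : b ⊔ p = ⊤ :=
      top_le_iff.1 (h.sup_eq_top ▸ sup_le le_sup_right ((show q ≤ b from hb).trans le_sup_left))
    have h2 : a ⊔ q = ⊤ :=
      top_le_iff.1 (h.sup_eq_top ▸ sup_le ((show p ≤ a from ha).trans le_sup_left) le_sup_right)
    refine Prod.ext (Subtype.ext ?_) (Subtype.ext ?_)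
    · change (a ⊓ b) ⊔ p = a
      rw [hsup, sup_eq_left.2 (show p ≤ a from ha), h1, inf_top_eq]
    · change (a ⊓ b) ⊔ q = b
      rw [hsup, sup_eq_left.2 (show q ≤ b from hb), h2, top_inf_eq]

/-- The BL-algebras with at most five elements that are not chains. -/
theorem IsBL.nonchain_cases [Finite L] (hL : IsBL L) (hc : ¬ IsChainAlg L)
    (h5 : Nat.card L ≤ 5) : (∀ x : L, x * x = x) ∧
      ((Nat.card L = 4 ∧ Nonempty (Bool × Bool ≃o L)) ∨
        (Nat.card L = 5 ∧ Nonempty (WithBot (Bool × Bool) ≃o L))) := by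
  obtain ⟨p, q, hpq, hp, hq⟩ : ∃ p q : L, p ⊔ q = ⊤ ∧ p ≠ ⊤ ∧ q ≠ ⊤ := by
    simp only [IsChainAlg, not_forall, not_or] at hc
    obtain ⟨x, y, hxy, hyx⟩ := hc
    exact ⟨x ⇝ y, y ⇝ x, hL.prel x y, mt imp_eq_top.1 hxy, mt imp_eq_top.1 hyx⟩
  obtain ⟨f, hf0, hf1, hf2, hf3⟩ := exists_orderEmbedding_square hpq hp hq
  have hmul : p * q = p ⊓ q := by
    refine le_antisymm (le_inf (mul_le_left _ _) (mul_le_right _ _)) ?_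
    calc p ⊓ q = (p ⊓ q) * p ⊔ (p ⊓ q) * q := by rw [← mul_sup_eq, hpq, mul_top]
      _ ≤ p * q := sup_le
        ((mul_le_mul_of_le inf_le_right le_rfl).trans (mul_comm q p).le)
        (mul_le_mul_of_le inf_le_left le_rfl)
  -- Expansion of `p = p * (p ⊔ q)`; this will force `p * p = p`.
  have hpp : p * p ⊔ p ⊓ q = p := by rw [← hmul, ← mul_sup_eq, hpq, mul_top]
  have hqq : q * q ⊔ p ⊓ q = q := by
    rw [← hmul, mul_comm p q, ← mul_sup_eq, sup_comm, hpq, mul_top]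
  by_cases hm : p ⊓ q = ⊥
  · have hp' : p * p = p := by rwa [hm, sup_bot_eq] at hpp
    have hq' : q * q = q := by rwa [hm, sup_bot_eq] at hqq
    have two_le : ∀ x : L, x ≠ ⊤ → 2 ≤ Nat.card (Set.Ici x) := fun x hx => by
      have : Nontrivial (Set.Ici x) :=
        ⟨⟨⟨x, le_rfl⟩, ⟨⊤, le_top⟩, fun e => hx (congrArg Subtype.val e)⟩⟩
      exact Finite.one_lt_card
    have hcard : Nat.card L = 4 := by
      have h := natCard_eq_mul_of_isCompl hL (IsCompl.of_eq hm hpq)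
      have h1 := two_le p hp
      have h2 := two_le q hq
      have h3 : Nat.card (Set.Ici p) = 2 := by nlinarith
      have h4 : Nat.card (Set.Ici q) = 2 := by nlinarith
      rw [h, h3, h4]
    have hsurj : Function.Surjective f :=
      (f.injective.bijective_of_nat_card_le (by rw [hcard]; simp)).surjective
    refine ⟨fun x => ?_, Or.inl ⟨hcard, ⟨RelIso.ofSurjective f hsurj⟩⟩⟩
    obtain ⟨⟨_ | _, _ | _⟩, rfl⟩ := hsurj x
    · rw [hf0, hm, mul_bot]
    · rw [hf2, hq']
    · rw [hf1, hp']
    · rw [hf3, mul_top]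
  -- Now `⊥` lies strictly below the square, so five elements are already found and they exhaust
  -- `L`.
  · have hfb : ∀ x, ¬ f x ≤ ⊥ := fun x h => hm <| by
      rw [← hf0, ← le_bot_iff]
      exact (f.le_iff_le.2 ⟨bot_le, bot_le⟩).trans h
    let g : WithBot (Bool × Bool) ↪o L := OrderEmbedding.ofMapLEIff
      (fun x => WithBot.recBotCoe ⊥ f x) fun x y => by
        induction x with
        | bot => simp
        | coe x =>
          induction y with
          | bot => simpa using hfb x
          | coe y => simp
    have hg5 : Nat.card (WithBot (Bool × Bool)) = 5 := by
      change Nat.card (Option (Bool × Bool)) = 5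
      simp
    have hcard : Nat.card L = 5 := by
      have := Nat.card_le_card_of_injective g g.injective
      omega
    have hsurj : Function.Surjective g :=
      (g.injective.bijective_of_nat_card_le (by rw [hcard, hg5])).surjective
    have hcov : ∀ x : L, x = ⊥ ∨ x = p ⊓ q ∨ x = q ∨ x = p ∨ x = ⊤ := fun x => by
      obtain ⟨y, rfl⟩ := hsurj x
      induction y with
      | bot => exact Or.inl rfl
      | coe y =>
        right
        obtain ⟨_ | _, _ | _⟩ := y
        · exact Or.inl hf0
        · exact Or.inr (Or.inl hf2)
        · exact Or.inr (Or.inr (Or.inl hf1))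
        · exact Or.inr (Or.inr (Or.inr hf3))
    -- In `a = a * a ⊔ a ⊓ b`, a square below `a ⊓ b` would give `a ≤ b` and hence `b = ⊤`; the
    -- values `b` and `⊤` would give `a = ⊤`.
    have idem : ∀ a b : L, a ⊔ b = ⊤ → a ≠ ⊤ → b ≠ ⊤ → a * a ⊔ a ⊓ b = a →
        (a * a = ⊥ ∨ a * a = a ⊓ b ∨ a * a = b ∨ a * a = a ∨ a * a = ⊤) → a * a = a := by
      intro a b hab ha hb haa h
      have hlow : ∀ c, c ≤ a ⊓ b → a * a = c → a * a = a := fun c hc he => by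
        rw [he, sup_eq_right.2 hc] at haa
        exact absurd (hab ▸ sup_eq_right.2 (inf_eq_left.1 haa)).symm hb
      rcases h with h | h | h | h | h
      · exact hlow _ bot_le h
      · exact hlow _ le_rfl h
      · exact absurd (hab ▸ sup_eq_left.2 (h ▸ mul_le_left a a)).symm ha
      · exact h
      · exact absurd (top_le_iff.1 (h ▸ mul_le_left a a)) ha
    have hp' : p * p = p := idem p q hpq hp hq hpp (hcov _)
    have hq' : q * q = q := by
      refine idem q p (by rw [sup_comm, hpq]) hq hp (by rwa [inf_comm]) ?_
      have := hcov (q * q)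
      rw [inf_comm q p]
      tauto
    refine ⟨fun x => ?_, Or.inr ⟨hcard, ⟨RelIso.ofSurjective g hsurj⟩⟩⟩
    rcases hcov x with rfl | rfl | rfl | rfl | rfl
    · exact mul_bot _
    · rw [← hmul, mul_mul_mul_comm, hp', hq']
    · exact hq'
    · exact hp'
    · exact mul_top _

theorem IsBL.nonempty_resIso_of_nonchain {M : Type v} [ResiduatedLattice M] [Finite L] [Finite M]
    (hL : IsBL L) (hM : IsBL M) (cL : ¬ IsChainAlg L) (cM : ¬ IsChainAlg M)
    (h5 : Nat.card L ≤ 5) (hLM : Nat.card L = Nat.card M) : Nonempty (ResIso L M) := by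
  obtain ⟨iL, hL'⟩ := hL.nonchain_cases cL h5
  obtain ⟨iM, hM'⟩ := hM.nonchain_cases cM (hLM ▸ h5)
  rcases hL' with ⟨cL, ⟨e⟩⟩ | ⟨cL, ⟨e⟩⟩ <;> rcases hM' with ⟨cM, ⟨f⟩⟩ | ⟨cM, ⟨f⟩⟩
  · exact ResIso.nonempty_of_idem hL hM iL iM (e.symm.trans f)
  · omega
  · omega
  · exact ResIso.nonempty_of_idem hL hM iL iM (e.symm.trans f)

end NonChain

/-! ### Involutive negation -/

section Involution

variable {L : Type u} [ResiduatedLattice L]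

theorem mul_rneg (x : L) : x * rneg x = ⊥ := le_bot_iff.1 (mul_imp_le x ⊥)

theorem le_rneg_iff {x y : L} : y ≤ rneg x ↔ x * y = ⊥ := by
  rw [rneg, le_imp_iff, le_bot_iff]

theorem rneg_bot : rneg (⊥ : L) = ⊤ := imp_eq_top.2 le_rfl

theorem rneg_mul (x y : L) : rneg (x * y) = (x ⇝ rneg y) := by
  refine eq_of_forall_le_iff fun z => ?_
  rw [le_imp_iff, le_rneg_iff, le_rneg_iff, mul_left_comm, mul_assoc]

/-- The MV-algebra of a BL-algebra with an involutive negation. -/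
@[reducible] def MVAlgebra.ofInvolutive (hL : IsBL L) (h : ∀ x : L, rneg (rneg x) = x) : MVAlgebra L where
  oplus x y := rneg (rneg x * rneg y)
  neg := rneg
  zero := ⊥
  oplus_assoc x y z := by rw [h, h, mul_assoc]
  oplus_comm x y := by rw [mul_comm]
  oplus_zero x := by rw [rneg_bot, mul_top, h]
  neg_neg := h
  oplus_neg_zero x := by rw [h, mul_bot]
  neg_oplus x y := by
    -- Divisibility turns each side of the Łukasiewicz identity into the negation of a meet, which
    -- is symmetric.
    have key : ∀ x y : L, rneg (rneg (rneg (rneg (rneg (rneg x) * rneg y))) * rneg y) =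
        rneg (rneg x ⊓ rneg y) := fun x y => by
      rw [h, h, mul_comm x, rneg_mul (rneg y) x, mul_comm, hL.div, inf_comm]
    rw [key, key, inf_comm]

theorem IsBL.isMV (hL : IsBL L) (h : ∀ x : L, rneg (rneg x) = x) : IsMV L :=
  ⟨.ofInvolutive hL h, rfl, fun _ => rfl, fun _ _ => rfl⟩

theorem ResIso.map_rneg {M : Type v} [ResiduatedLattice M] (e : ResIso L M) (x : L) :
    e.toFun (rneg x) = rneg (e.toFun x) := by
  rw [rneg, e.map_imp, e.map_bot, rneg]

/-- A complement `c` of `x` lies below `x*`, so `x** ⊙ c = 0` and `x** = x** ⊙ (x ∨ c) ≤ x`. -/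
theorem IsBL.rneg_rneg_of_complemented (hL : IsBL L) (hi : ∀ x : L, x * x = x)
    [ComplementedLattice L] (x : L) : rneg (rneg x) = x := by
  obtain ⟨c, hc⟩ := exists_isCompl x
  refine le_antisymm ?_ (le_rneg_iff.2 (by rw [mul_comm, mul_rneg]))
  have hcx : c ≤ rneg x := le_rneg_iff.2 (by rw [hL.idem_mul (hi x), hc.inf_eq_bot])
  calc rneg (rneg x) = rneg (rneg x) * x ⊔ rneg (rneg x) * c := by
        rw [← mul_sup_eq, hc.sup_eq_top, mul_top]
    _ ≤ x := sup_le (mul_le_right _ _) <| by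
        refine (mul_le_mul_of_le le_rfl hcx).trans ?_
        rw [mul_comm, mul_rneg]
        exact bot_le

/-- Without interior idempotents the product has rank `φ y + φ z - k`, truncated at `0`; hence
negation reverses the ranks. -/
theorem IsRanking.rneg_rneg {φ : L → ℕ} {k : ℕ} (h : IsRanking φ k) (hL : IsBL L)
    (hi : ∀ i, IsRanking.Idem φ i → i = 0 ∨ i = k) (x : L) : rneg (rneg x) = x := by
  have hmul : ∀ y z : L, φ (y * z) = φ y + φ z - k := fun y z => by
    have hz := h.le z
    have := h.rank_mul_between hL (mul_bot ⊥) (mul_top ⊤)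
      (fun c hc h0 h1 => ?_) (k - φ z) y z (by rw [h.top]; omega) bot_le le_top bot_le
    · rw [this, h.bot]
      omega
    · rw [h.lt_iff, h.bot] at h0
      rw [h.lt_iff, h.top] at h1
      have := hi _ ⟨c, hc, rfl⟩
      omega
  have hneg : ∀ y, φ (rneg y) = k - φ y := fun y => by
    have h1 := hmul y (rneg y)
    rw [mul_rneg, h.bot] at h1
    obtain ⟨z, hz⟩ := (h.exists_iff (k - φ y)).2 (Nat.sub_le _ _)
    have hy := h.le y
    have h2 := hmul y z
    have h3 : y * z = ⊥ := h.injective (by rw [h2, h.bot]; omega)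
    have h4 := (h.le_iff _ _).1 (le_rneg_iff.2 h3)
    omega
  have := h.le x
  exact h.injective (by rw [hneg, hneg]; omega)

/-- If the negation is involutive, the only idempotents comparable to everything are `⊥` and `⊤`. -/
theorem IsBL.eq_of_idem_of_involutive (hL : IsBL L) (h : ∀ x : L, rneg (rneg x) = x) {a : L}
    (ha : a * a = a) (hc : ∀ x, a ≤ x ∨ x ≤ a) : a = ⊥ ∨ a = ⊤ := by
  have h0 : a ⊓ rneg a = ⊥ := by rw [← hL.idem_mul ha, mul_rneg]
  rcases hc (rneg a) with h1 | h1
  · left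
    rwa [inf_eq_left.2 h1] at h0
  · right
    rw [inf_eq_right.2 h1] at h0
    rw [← h a, h0, rneg_bot]

end Involution

/-! ### MV-algebras as BL-algebras with involutive negation -/

namespace MVAlgebra

local infixl:65 " ⊕ₘ " => MVAlgebra.oplus
local prefix:max "∼" => MVAlgebra.neg
local notation "𝟘" => MVAlgebra.zero
local notation "𝟙" => MVAlgebra.neg MVAlgebra.zero

section Order

variable {L : Type u} [MVAlgebra L]

theorem zero_oplus (x : L) : 𝟘 ⊕ₘ x = x := by rw [oplus_comm, oplus_zero]

theorem one_oplus (x : L) : 𝟙 ⊕ₘ x = 𝟙 := by rw [oplus_comm, oplus_neg_zero]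

theorem oplus_left_comm (x y z : L) : x ⊕ₘ (y ⊕ₘ z) = y ⊕ₘ (x ⊕ₘ z) := by
  rw [← oplus_assoc, oplus_comm x y, oplus_assoc]

theorem neg_oplus_self (x : L) : ∼x ⊕ₘ x = 𝟙 := by
  have h := neg_oplus x (𝟙 : L)
  rw [oplus_neg_zero, neg_neg, zero_oplus] at h
  exact h.symm

/-- The product of an MV-algebra. -/
def prod (x y : L) : L := ∼(∼x ⊕ₘ ∼y)

/-- The join of an MV-algebra. -/
def join (x y : L) : L := ∼(∼x ⊕ₘ y) ⊕ₘ y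

/-- The order of an MV-algebra. -/
def LE (x y : L) : Prop := ∼x ⊕ₘ y = 𝟙

theorem LE.refl (x : L) : LE x x := neg_oplus_self x

theorem LE.antisymm {x y : L} (h : LE x y) (h' : LE y x) : x = y := by
  have e := neg_oplus x y
  rw [show ∼x ⊕ₘ y = 𝟙 from h, show ∼y ⊕ₘ x = 𝟙 from h', neg_neg, zero_oplus, zero_oplus] at e
  exact e.symm

theorem join_comm (x y : L) : join x y = join y x := neg_oplus x y

theorem join_eq_of_le {x y : L} (h : LE x y) : join x y = y := by
  rw [join, show ∼x ⊕ₘ y = 𝟙 from h, neg_neg, zero_oplus]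

theorem LE.oplus_right (x y : L) : LE x (x ⊕ₘ y) := by
  rw [LE, ← oplus_assoc, neg_oplus_self, one_oplus]

/-- Commutativity of the join gives `y = (y ⊖ x) ⊕ x`. Transitivity and monotonicity of the order
then reduce to associativity. -/
theorem LE.exists_eq {x y : L} (h : LE x y) : ∃ z, y = x ⊕ₘ z := by
  refine ⟨∼(∼y ⊕ₘ x), ?_⟩
  rw [oplus_comm]
  exact (join_eq_of_le h).symm.trans (join_comm x y)

theorem LE.trans {x y z : L} (h : LE x y) (h' : LE y z) : LE x z := by
  obtain ⟨a, rfl⟩ := h.exists_eq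
  obtain ⟨b, rfl⟩ := h'.exists_eq
  rw [oplus_assoc]
  exact LE.oplus_right _ _

theorem LE.oplus_mono {x y : L} (h : LE x y) (z : L) : LE (x ⊕ₘ z) (y ⊕ₘ z) := by
  obtain ⟨a, rfl⟩ := h.exists_eq
  rw [oplus_assoc, oplus_comm a, ← oplus_assoc]
  exact LE.oplus_right _ _

theorem LE.neg {x y : L} (h : LE x y) : LE (∼y) (∼x) := by
  rw [LE, neg_neg, oplus_comm]
  exact h

theorem LE.of_neg {x y : L} (h : LE (∼y) (∼x)) : LE x y := by
  have := h.neg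
  rwa [neg_neg, neg_neg] at this

theorem LE.join_right (x y : L) : LE y (join x y) := by
  rw [join, oplus_comm]
  exact LE.oplus_right _ _

theorem LE.join_left (x y : L) : LE x (join x y) := by
  rw [join_comm]
  exact LE.join_right _ _

theorem LE.join_le {x y z : L} (h : LE x z) (h' : LE y z) : LE (join x y) z := by
  have e : join z y = z := by rw [join_comm, join_eq_of_le h']
  rw [← e]
  exact ((h.neg.oplus_mono y).neg).oplus_mono y

theorem prod_comm (x y : L) : prod x y = prod y x := by rw [prod, prod, oplus_comm]

theorem prod_assoc (x y z : L) : prod (prod x y) z = prod x (prod y z) := by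
  rw [prod, prod, prod, prod, neg_neg, neg_neg, oplus_assoc]

theorem prod_le_iff (x y z : L) : LE (prod x z) y ↔ LE z (∼x ⊕ₘ y) := by
  rw [LE, LE, prod, neg_neg, oplus_assoc, oplus_left_comm]

/-- `x ⊖ y` and `y ⊖ x` are disjoint. -/
theorem prod_neg_le (x y : L) :
    LE (prod (prod x (∼y)) (∼(prod x (∼y)) ⊕ₘ prod y (∼x))) 𝟘 := by
  have hdiv : ∀ a b : L, prod a (∼a ⊕ₘ b) = prod b (∼b ⊕ₘ a) := fun a b => by
    have := neg_oplus (∼b) (∼a)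
    rw [prod, prod]
    rw [neg_neg, neg_neg] at this
    rw [oplus_comm (∼a) (∼(∼a ⊕ₘ b)), oplus_comm (∼b) (∼(∼b ⊕ₘ a)), oplus_comm (∼a) b,
      oplus_comm (∼b) a, this]
  have hle : ∀ a b : L, LE (prod a (∼a ⊕ₘ b)) b := fun a b => (prod_le_iff _ _ _).2 (LE.refl _)
  have hml : ∀ a b : L, LE (prod a b) a := fun a b => (prod_le_iff _ _ _).2 (by
    rw [neg_oplus_self]
    exact oplus_neg_zero _)
  have hmono : ∀ {a b : L} (c : L), LE a b → LE (prod c a) (prod c b) := fun c h => by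
    rw [prod_comm c, prod_comm c]
    exact (h.neg.oplus_mono (∼c)).neg
  set b := prod y (∼x) with hb
  set w := ∼(y ⊕ₘ b) with hw
  have e1 : ∼(prod x (∼y)) ⊕ₘ b = ∼x ⊕ₘ (y ⊕ₘ b) := by rw [prod, neg_neg, neg_neg, oplus_assoc]
  -- Divisibility is used twice: to exchange `x` with `y ⊕ b`, and then `∼y` with `b`. Here `w ⊕ x`
  -- is the residuum of `y ⊕ b` and `x`.
  have e2 : prod (prod x (∼y)) (∼x ⊕ₘ (y ⊕ₘ b)) =
      prod b (prod (∼b ⊕ₘ ∼y) (w ⊕ₘ x)) := by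
    rw [prod_comm x, prod_assoc, hdiv x, ← prod_assoc, ← prod_assoc]
    congr 1
    -- The exchange of `∼y` with `b`.
    have := hdiv (∼y) b
    rwa [neg_neg] at this
  -- Since `b = y ⊙ ∼x` and `∼x ⊙ (w ⊕ x) ≤ w ≤ ∼y`, the product is at most `y ⊙ ∼y = 0`.
  have e3 : LE (prod b (w ⊕ₘ x)) 𝟘 := by
    have h1 : LE (prod (∼x) (w ⊕ₘ x)) w := by
      have := hle (∼x) w
      rwa [neg_neg, oplus_comm] at this
    have h2 : LE w (∼y) := (LE.oplus_right y b).neg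
    have h3 : LE (prod y (∼y)) 𝟘 := by
      rw [prod_le_iff, oplus_zero]
      exact LE.refl _
    rw [hb, prod_assoc]
    exact (hmono y (h1.trans h2)).trans h3
  rw [e1, e2]
  refine (hmono b ?_).trans e3
  rw [prod_comm]
  exact hml _ _

end Order

variable {L : Type u}

/-- The residuated lattice of an MV-algebra. -/
@[reducible] def toResiduatedLattice (M : MVAlgebra L) : ResiduatedLattice L where
  le := LE
  le_refl := LE.refl
  le_trans _ _ _ := LE.trans
  le_antisymm _ _ := LE.antisymm
  sup := join
  le_sup_left := LE.join_left
  le_sup_right := LE.join_right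
  sup_le _ _ _ := LE.join_le
  inf x y := ∼(join (∼x) (∼y))
  inf_le_left x y := LE.of_neg (by rw [neg_neg]; exact LE.join_left _ _)
  inf_le_right x y := LE.of_neg (by rw [neg_neg]; exact LE.join_right _ _)
  le_inf x y z h h' := LE.of_neg (by rw [neg_neg]; exact LE.join_le h.neg h'.neg)
  bot := 𝟘
  top := 𝟙
  bot_le x := by
    rw [LE, one_oplus]
  le_top x := oplus_neg_zero _
  mul := prod
  mul_assoc := prod_assoc
  mul_comm := prod_comm
  one := 𝟙
  one_mul x := by
    change prod 𝟙 x = x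
    rw [prod, neg_neg, zero_oplus, neg_neg]
  mul_one x := by
    change prod x 𝟙 = x
    rw [prod, neg_neg, oplus_zero, neg_neg]
  imp x y := ∼x ⊕ₘ y
  one_eq_top := rfl
  mul_mono _ _ z h := (h.neg.oplus_mono (∼z)).neg
  le_imp_iff x y z := (prod_le_iff x y z).symm

/-- Prelinearity is the negation of the disjointness of `x ⊖ y` and `y ⊖ x`. -/
theorem isBL_toResiduatedLattice (M : MVAlgebra L) : @IsBL L M.toResiduatedLattice := by
  let _ := M.toResiduatedLattice
  have hdiv : ∀ x y : L, x * (x ⇝ y) = x ⊓ y := fun x y => by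
    change ∼(∼x ⊕ₘ ∼(∼x ⊕ₘ y)) = ∼(join (∼x) (∼y))
    rw [join_comm, join, neg_neg, oplus_comm (∼x), oplus_comm y]
  refine ⟨fun x y => ?_, hdiv⟩
  have h := LE.antisymm (prod_neg_le x y) (bot_le (α := L))
  have h' : prod x (∼y) ⊓ prod y (∼x) = 𝟘 := by
    rw [← hdiv]
    exact h
  have e : ∀ a b : L, ∼(prod a (∼b)) = ∼a ⊕ₘ b := fun a b => by rw [prod, neg_neg, neg_neg]
  change ∼(join (∼(prod x (∼y))) (∼(prod y (∼x)))) = 𝟘 at h'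
  rw [e, e] at h'
  change join (∼x ⊕ₘ y) (∼y ⊕ₘ x) = 𝟙
  rw [← h', neg_neg]

theorem rneg_toResiduatedLattice (M : MVAlgebra L) (x : L) :
    @rneg L M.toResiduatedLattice x = M.neg x := oplus_zero _

theorem rneg_rneg_toResiduatedLattice (M : MVAlgebra L) (x : L) :
    @rneg L M.toResiduatedLattice (@rneg L M.toResiduatedLattice x) = x := by
  rw [rneg_toResiduatedLattice, rneg_toResiduatedLattice, neg_neg]

theorem nonempty_mvIso_iff {K : Type v} (M : MVAlgebra L) (N : MVAlgebra K) :
    Nonempty (MVIso L K) ↔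
      Nonempty (@ResIso L K M.toResiduatedLattice N.toResiduatedLattice) := by
  let _ := M.toResiduatedLattice
  let _ := N.toResiduatedLattice
  constructor
  · rintro ⟨e⟩
    have hle : ∀ x y : L, e.toEquiv x ≤ e.toEquiv y ↔ x ≤ y := fun x y => by
      change ∼(e.toFun x) ⊕ₘ e.toFun y = 𝟙 ↔ ∼x ⊕ₘ y = 𝟙
      rw [← e.map_neg, ← e.map_oplus, ← e.map_zero, ← e.map_neg]
      exact e.toEquiv.injective.eq_iff
    refine ⟨ResIso.ofOrderIso ⟨e.toEquiv, hle _ _⟩ fun x y => ?_⟩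
    change e.toFun (∼(∼x ⊕ₘ ∼y)) = ∼(∼(e.toFun x) ⊕ₘ ∼(e.toFun y))
    rw [e.map_neg, e.map_oplus, e.map_neg, e.map_neg]
  · rintro ⟨e⟩
    have hneg : ∀ x, e.toFun (∼x) = ∼(e.toFun x) := fun x => by
      rw [← rneg_toResiduatedLattice, e.map_rneg, rneg_toResiduatedLattice]
    refine ⟨{ e.toEquiv with map_oplus := fun x y => ?_, map_neg := hneg, map_zero := e.map_bot }⟩
    have := e.map_imp (∼x) y
    change e.toFun (∼(∼x) ⊕ₘ y) = ∼(e.toFun (∼x)) ⊕ₘ e.toFun y at this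
    rwa [hneg, neg_neg, neg_neg] at this

/-- The passage to the MV-algebra and back changes neither order nor product, so the identity map is
an isomorphism. -/
theorem nonempty_resIso_ofInvolutive [ResiduatedLattice L] (hL : IsBL L)
    (h : ∀ x : L, rneg (rneg x) = x) :
    Nonempty (@ResIso L L _ (ofInvolutive hL h).toResiduatedLattice) := by
  have hle : ∀ x y : L, @LE L (ofInvolutive hL h) x y ↔ x ≤ y := fun x y => by
    change rneg (rneg (rneg x) * rneg y) = rneg ⊥ ↔ _
    rw [h, rneg_mul, h, rneg_bot, imp_eq_top]
  refine ⟨@ResIso.ofOrderIso L L _ (ofInvolutive hL h).toResiduatedLattice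
    (@RelIso.mk L L (· ≤ ·) (@LE L (ofInvolutive hL h)) (Equiv.refl L) (hle _ _)) fun x y => ?_⟩
  change x * y = rneg (rneg (rneg (rneg x) * rneg (rneg y)))
  rw [h, h, h]

end MVAlgebra

/-- The structure of a residuated lattice carried over along a bijection. -/
@[reducible] def ResiduatedLattice.transfer {α : Type u} {L : Type v} [ResiduatedLattice L]
    (e : α ≃ L) : ResiduatedLattice α where
  le x y := e x ≤ e y
  le_refl _ := le_rfl
  le_trans _ _ _ h h' := h.trans h'
  le_antisymm _ _ h h' := e.injective (le_antisymm h h')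
  sup x y := e.symm (e x ⊔ e y)
  le_sup_left x y := by simp
  le_sup_right x y := by simp
  sup_le x y z h h' := by simpa using ⟨h, h'⟩
  inf x y := e.symm (e x ⊓ e y)
  inf_le_left x y := by simp
  inf_le_right x y := by simp
  le_inf x y z h h' := by simpa using ⟨h, h'⟩
  bot := e.symm ⊥
  top := e.symm ⊤
  bot_le x := by
    simp
  le_top x := by
    simp
  mul x y := e.symm (e x * e y)
  mul_assoc x y z := by
    change e.symm (e (e.symm (e x * e y)) * e z) = e.symm (e x * e (e.symm (e y * e z)))
    simp [mul_assoc]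
  mul_comm x y := by
    change e.symm (e x * e y) = e.symm (e y * e x)
    rw [mul_comm]
  one := e.symm ⊤
  one_mul x := by
    change e.symm (e (e.symm ⊤) * e x) = x
    simp [top_mul]
  mul_one x := by
    change e.symm (e x * e (e.symm ⊤)) = x
    simp [mul_top]
  imp x y := e.symm (e x ⇝ e y)
  one_eq_top := rfl
  mul_mono x y z h := by
    change e (e.symm (e x * e z)) ≤ e (e.symm (e y * e z))
    simpa using mul_mono _ _ (e z) h
  le_imp_iff x y z := by
    change e z ≤ e (e.symm (e x ⇝ e y)) ↔ e (e.symm (e x * e z)) ≤ e y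
    simpa using le_imp_iff (e x) (e y) (e z)

/-- The bijection along which a structure was carried over is an isomorphism. -/
def ResIso.ofTransfer {α : Type u} {L : Type v} [ResiduatedLattice L] (e : α ≃ L) :
    @ResIso α L (ResiduatedLattice.transfer e) _ :=
  letI := ResiduatedLattice.transfer e
  ResIso.ofOrderIso ⟨e, Iff.rfl⟩ fun x y => e.apply_symm_apply (e x * e y)

/-! ### The places of idempotents as a complete invariant -/

section IdemRanks

/-- The places of the idempotents of a chain (no numbers at all if `L` is not a chain). -/
def idemRanks (L : Type u) [ResiduatedLattice L] : Set ℕ :=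
  {i | ∃ (φ : L → ℕ) (k : ℕ), IsRanking φ k ∧ IsRanking.Idem φ i}

variable {L : Type u} {M : Type v} [ResiduatedLattice L] [ResiduatedLattice M] {k : ℕ}

theorem IsRanking.mem_idemRanks {φ : L → ℕ} (h : IsRanking φ k) {i : ℕ} :
    i ∈ idemRanks L ↔ IsRanking.Idem φ i := by
  constructor
  · rintro ⟨ψ, l, hψ, hi⟩
    rwa [h.unique hψ]
  · exact fun hi => ⟨φ, k, h, hi⟩

theorem idemRanks_eq_empty (h : ¬ IsChainAlg L) : idemRanks L = ∅ :=
  Set.eq_empty_of_forall_notMem fun _ ⟨_, _, hφ, _⟩ => h hφ.isChainAlg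

/-- The place `0` always occurs, so the value `∅` is reserved for non-chains. -/
theorem IsRanking.idemRanks_ne_empty {φ : L → ℕ} (h : IsRanking φ k) : idemRanks L ≠ ∅ := fun e =>
  (e ▸ h.mem_idemRanks.2 h.idem_zero : 0 ∈ (∅ : Set ℕ))

theorem ResIso.idemRanks_eq (e : ResIso L M) : idemRanks L = idemRanks M := by
  have key : ∀ {L : Type u} {M : Type v} [ResiduatedLattice L] [ResiduatedLattice M],
      ResIso L M → idemRanks M ⊆ idemRanks L := by
    rintro L M _ _ e i ⟨φ, k, hφ, y, hy, rfl⟩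
    obtain ⟨x, rfl⟩ := e.toEquiv.surjective y
    exact ⟨_, k, hφ.comp e, x, e.injective (by rw [e.map_mul]; exact hy), rfl⟩
  have key' : ∀ {L : Type v} {M : Type u} [ResiduatedLattice L] [ResiduatedLattice M],
      ResIso L M → idemRanks M ⊆ idemRanks L := by
    rintro L M _ _ e i ⟨φ, k, hφ, y, hy, rfl⟩
    obtain ⟨x, rfl⟩ := e.toEquiv.surjective y
    exact ⟨_, k, hφ.comp e, x, e.injective (by rw [e.map_mul]; exact hy), rfl⟩
  exact (key' e.symm).antisymm (key e)

/-- BL-algebras with the same number of elements, at most five, are isomorphic iff they have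
idempotents at the same places. -/
theorem IsBL.nonempty_resIso_iff [Finite L] [Finite M] (hL : IsBL L) (hM : IsBL M)
    (cL : Nat.card L = k + 1) (cM : Nat.card M = k + 1) (hk : k ≤ 4) :
    Nonempty (ResIso L M) ↔ idemRanks L = idemRanks M := by
  refine ⟨fun ⟨e⟩ => e.idemRanks_eq, fun h => ?_⟩
  by_cases hcL : IsChainAlg L
  · obtain ⟨φ, hφ⟩ := IsRanking.exists_of_isChainAlg hcL cL
    by_cases hcM : IsChainAlg M
    · obtain ⟨ψ, hψ⟩ := IsRanking.exists_of_isChainAlg hcM cM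
      exact hφ.nonempty_resIso hψ hL hM fun i => by
        rw [← hφ.mem_idemRanks, h, hψ.mem_idemRanks]
    · exact absurd (h.trans (idemRanks_eq_empty hcM)) hφ.idemRanks_ne_empty
  · by_cases hcM : IsChainAlg M
    · obtain ⟨ψ, hψ⟩ := IsRanking.exists_of_isChainAlg hcM cM
      exact absurd (h.symm.trans (idemRanks_eq_empty hcL)) hψ.idemRanks_ne_empty
    · exact hL.nonempty_resIso_of_nonchain hM hcL hcM (by omega) (by omega)

end IdemRanks

theorem exists_nonchain_four : ∃ (L : Type) (_ : ResiduatedLattice L), Finite L ∧ IsBL L ∧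
    ¬ IsChainAlg L ∧ Nat.card L = 4 ∧ ∀ x : L, rneg (rneg x) = x := by
  have hfin : Finite (Ideal (ZMod 2 × ZMod 2)) :=
    Nat.finite_of_card_ne_zero (by rw [natCard_ideal_zmod_prod]; norm_num)
  have : ComplementedLattice (Ideal (ZMod 2 × ZMod 2)) :=
    (inferInstance : ComplementedLattice (Submodule (ZMod 2 × ZMod 2) (ZMod 2 × ZMod 2)))
  have h := isBL_ideal_of_complementedLattice (ZMod 2 × ZMod 2)
  exact ⟨_, _, hfin, h.1, not_isChainAlg_ideal_zmod_prod, natCard_ideal_zmod_prod,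
    h.1.rneg_rneg_of_complemented h.2⟩

theorem natCard_ideal_zmod_two_pow (k : ℕ) : Nat.card (Ideal (ZMod (2 ^ k))) = k + 1 := by
  obtain ⟨φ, hφ, -⟩ := exists_isRanking_ideal_zmod k
  exact hφ.natCard

theorem nonchain_ordProd_five :
    ¬ IsChainAlg (OrdProd (Ideal (ZMod (2 ^ 1))) (Ideal (ZMod 2 × ZMod 2))) ∧
    Finite (OrdProd (Ideal (ZMod (2 ^ 1))) (Ideal (ZMod 2 × ZMod 2))) ∧
    Nat.card (OrdProd (Ideal (ZMod (2 ^ 1))) (Ideal (ZMod 2 × ZMod 2))) = 5 ∧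
    IsBL (OrdProd (Ideal (ZMod (2 ^ 1))) (Ideal (ZMod 2 × ZMod 2))) := by
  have h1 := natCard_ideal_zmod_two_pow 1
  have h2 := natCard_ideal_zmod_prod
  have f1 : Finite (Ideal (ZMod (2 ^ 1))) := Nat.finite_of_card_ne_zero (by rw [h1]; norm_num)
  have f2 : Finite (Ideal (ZMod 2 × ZMod 2)) := Nat.finite_of_card_ne_zero (by rw [h2]; norm_num)
  have h3 := OrdProd.natCard (Ideal (ZMod (2 ^ 1))) (Ideal (ZMod 2 × ZMod 2))
  have h4 : Nat.card (OrdProd (Ideal (ZMod (2 ^ 1))) (Ideal (ZMod 2 × ZMod 2))) = 5 := by omega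
  exact ⟨fun h => not_isChainAlg_ideal_zmod_prod fun x y => h (.hi x) (.hi y),
    Nat.finite_of_card_ne_zero (by rw [h4]; norm_num), h4,
    OrdProd.isBL (isBL_ideal_zmod 1) (isChainAlg_ideal_zmod 1) isBL_ideal_zmod_prod⟩

/-- A BL-algebra with five elements and an involutive negation is a chain. -/
theorem IsBL.natCard_ne_five_of_involutive {L : Type u} [ResiduatedLattice L] [Finite L]
    (hL : IsBL L) (hc : ¬ IsChainAlg L) (h : ∀ x : L, rneg (rneg x) = x) : Nat.card L ≠ 5 := by
  intro h5
  obtain ⟨hi, ⟨h4, -⟩ | ⟨-, ⟨e⟩⟩⟩ := hL.nonchain_cases hc h5.le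
  · omega
  -- The bottom of the square is idempotent and comparable to everything, but is neither `⊥` nor
  -- `⊤`.
  · have hm : ∀ x, e (((false, false) : Bool × Bool) : WithBot (Bool × Bool)) ≤ x ∨
        x ≤ e (((false, false) : Bool × Bool) : WithBot (Bool × Bool)) := fun x => by
      obtain ⟨y, rfl⟩ := e.surjective x
      rw [e.le_iff_le, e.le_iff_le]
      induction y with
      | bot => exact Or.inr bot_le
      | coe y => exact Or.inl (WithBot.coe_le_coe.2 ⟨bot_le, bot_le⟩)
    rcases hL.eq_of_idem_of_involutive h (hi _) hm with h | h
    · rw [← e.map_bot, e.injective.eq_iff] at h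
      exact WithBot.coe_ne_bot h
    · have h' : ⊤ ≤ e (((false, false) : Bool × Bool) : WithBot (Bool × Bool)) := h.ge
      have := (le_top (a := e (((true, true) : Bool × Bool) : WithBot (Bool × Bool)))).trans h'
      rw [e.le_iff_le, WithBot.coe_le_coe] at this
      exact absurd this.1 (by decide)

/-- A chain without interior idempotents and the four-element square have involutive negation, hence
are MV. The remaining chains split at an interior idempotent, and the five-element non-chain is a
two-element chain below the square. -/
theorem IsBL.exists_ordProd {L : Type u} [ResiduatedLattice L] (hL : IsBL L)
    (h2 : 2 ≤ Nat.card L) (h5 : Nat.card L ≤ 5) (hMV : ¬ IsMV L) :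
    ∃ (A B : Type) (iA : ResiduatedLattice A) (iB : ResiduatedLattice B),
      BuiltFromIdeals A iA ∧ BuiltFromIdeals B iB ∧ IsBL A ∧ IsBL B ∧ IsChainAlg A ∧
      Nontrivial A ∧ Nontrivial B ∧ Nonempty (ResIso L (OrdProd A B)) := by
  have hfin : Finite L := Nat.finite_of_card_ne_zero (by omega)
  obtain ⟨k, hk⟩ : ∃ k, Nat.card L = k + 1 := ⟨Nat.card L - 1, by omega⟩
  by_cases hc : IsChainAlg L
  · obtain ⟨φ, hφ⟩ := IsRanking.exists_of_isChainAlg hc hk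
    obtain ⟨A, iA, -, blA, ⟨ψ, hψ, hψS⟩, hA⟩ := exists_chain_model k (by omega)
      {i | IsRanking.Idem φ i} hφ.idem_zero hφ.idem_last (by rintro i ⟨x, -, rfl⟩; exact hφ.le x)
    obtain ⟨e⟩ := hφ.nonempty_resIso hψ hL blA fun i => (hψS i).symm
    by_cases hr : ∃ r ∈ {i | IsRanking.Idem φ i}, 0 < r ∧ r < k
    · obtain ⟨B, C, iB, iC, bB, bC, blB, blC, cB, nB, nC, ⟨f⟩⟩ := hA hr
      exact ⟨B, C, iB, iC, bB, bC, blB, blC, cB, nB, nC, ⟨e.trans f⟩⟩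
    · refine absurd (hL.isMV (hφ.rneg_rneg hL fun i hi => ?_)) hMV
      have hik : i ≤ k := by
        obtain ⟨x, -, rfl⟩ := hi
        exact hφ.le x
      by_contra! h
      exact hr ⟨i, hi, by omega, by omega⟩
  · obtain ⟨hi, ⟨h4, ⟨e⟩⟩ | ⟨h5', -⟩⟩ := hL.nonchain_cases hc h5
    · have := e.complementedLattice
      exact absurd (hL.isMV (hL.rneg_rneg_of_complemented hi)) hMV
    · obtain ⟨cM, fM, nM, bM⟩ := nonchain_ordProd_five
      have h1 := natCard_ideal_zmod_two_pow 1
      have n1 : Nontrivial (Ideal (ZMod (2 ^ 1))) := by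
        have := Nat.finite_of_card_ne_zero (α := Ideal (ZMod (2 ^ 1))) (by omega)
        exact Finite.one_lt_card_iff_nontrivial.1 (by omega)
      exact ⟨_, _, _, _, .zmod 1 le_rfl, .zmod_prod, isBL_ideal_zmod 1, isBL_ideal_zmod_prod,
        isChainAlg_ideal_zmod 1, n1, inferInstance,
        hL.nonempty_resIso_of_nonchain bM hc cM h5 (h5'.trans nM.symm)⟩

/-! ### Counting isomorphism classes by the values of the invariant -/

section Counting

/-- The places of idempotents, as an invariant of the structures on `{0, …, n - 1}`. -/
def blInvariant (n : ℕ) (R : {R : ResiduatedLattice (Fin n) // @IsBL (Fin n) R}) : Set ℕ :=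
  @idemRanks (Fin n) R.1

/-- Carries a model over to `Fin n`; involutivity is transported along for the MV count. -/
theorem exists_blInvariant_eq {L : Type u} [ResiduatedLattice L] (hL : IsBL L) [Finite L] {n : ℕ}
    (hn : Nat.card L = n) : ∃ R, blInvariant n R = idemRanks L ∧
      ((∀ x : L, rneg (rneg x) = x) → ∀ x, @rneg _ R.1 (@rneg _ R.1 x) = x) := by
  have e : Fin n ≃ L := (Finite.equivFinOfCardEq hn).symm
  let R : ResiduatedLattice (Fin n) := ResiduatedLattice.transfer e
  have f : ResIso (Fin n) L := ResIso.ofTransfer e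
  exact ⟨⟨R, f.symm.isBL hL⟩, f.idemRanks_eq, fun h x => f.injective (by
    rw [f.map_rneg, f.map_rneg, h])⟩

theorem mem_range_blInvariant {k : ℕ} (h1 : 1 ≤ k) (h4 : k ≤ 4) (S : Set ℕ) :
    S ∈ Set.range (blInvariant (k + 1)) ↔
      (0 ∈ S ∧ k ∈ S ∧ ∀ i ∈ S, i ≤ k) ∨ (S = ∅ ∧ (k = 3 ∨ k = 4)) := by
  constructor
  · rintro ⟨⟨R, hR⟩, rfl⟩
    by_cases hc : IsChainAlg (Fin (k + 1))
    · left
      obtain ⟨φ, hφ⟩ := IsRanking.exists_of_isChainAlg hc (Nat.card_fin (k + 1))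
      simp only [blInvariant, hφ.mem_idemRanks]
      exact ⟨hφ.idem_zero, hφ.idem_last, by rintro i ⟨x, -, rfl⟩; exact hφ.le x⟩
    · right
      refine ⟨idemRanks_eq_empty hc, ?_⟩
      have := (hR.nonchain_cases hc (by rw [Nat.card_fin]; omega)).2
      rw [Nat.card_fin] at this
      omega
  · rintro (⟨h0, hk, hS⟩ | ⟨rfl, rfl | rfl⟩)
    · obtain ⟨A, iA, -, blA, ⟨φ, hφ, hφS⟩, -⟩ := exists_chain_model k h1 S h0 hk hS
      have : Finite A := Nat.finite_of_card_ne_zero (by rw [hφ.natCard]; omega)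
      obtain ⟨R, hR, -⟩ := exists_blInvariant_eq blA hφ.natCard
      refine ⟨R, hR.trans ?_⟩
      ext i
      rw [hφ.mem_idemRanks, hφS]
    · obtain ⟨L, _, _, bL, cL, nL, -⟩ := exists_nonchain_four
      obtain ⟨R, hR, -⟩ := exists_blInvariant_eq bL nL
      exact ⟨R, hR.trans (idemRanks_eq_empty cL)⟩
    · obtain ⟨cL, _, nL, bL⟩ := nonchain_ordProd_five
      obtain ⟨R, hR, -⟩ := exists_blInvariant_eq bL nL
      exact ⟨R, hR.trans (idemRanks_eq_empty cL)⟩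

theorem natCard_quotient_eq_ncard_range {α : Type u} {β : Type v} (s : Setoid α) (f : α → β)
    (h : ∀ x y, s.r x y ↔ f x = f y) : Nat.card (Quotient s) = (Set.range f).ncard := by
  obtain rfl : s = Setoid.ker f := Setoid.ext h
  exact (Nat.card_congr (Setoid.quotientKerEquivRange f)).trans (Nat.card_coe_set_eq _)

theorem numBL_eq_ncard {k : ℕ} (h4 : k ≤ 4) :
    numBL (k + 1) = (Set.range (blInvariant (k + 1))).ncard :=
  natCard_quotient_eq_ncard_range _ _ fun R S =>
    @IsBL.nonempty_resIso_iff _ _ R.1 S.1 k _ _ R.2 S.2 (Nat.card_fin _) (Nat.card_fin _) h4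

/-- The BL-algebra of an MV-algebra. -/
def mvToBL (n : ℕ) (M : MVAlgebra (Fin n)) : {R : ResiduatedLattice (Fin n) // @IsBL (Fin n) R} :=
  ⟨M.toResiduatedLattice, M.isBL_toResiduatedLattice⟩

theorem numMV_eq_ncard {k : ℕ} (h4 : k ≤ 4) :
    numMV (k + 1) = (Set.range (blInvariant (k + 1) ∘ mvToBL (k + 1))).ncard :=
  natCard_quotient_eq_ncard_range _ _ fun M N =>
    (M.nonempty_mvIso_iff N).trans <|
      @IsBL.nonempty_resIso_iff _ _ M.toResiduatedLattice N.toResiduatedLattice k _ _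
        M.isBL_toResiduatedLattice N.isBL_toResiduatedLattice (Nat.card_fin _) (Nat.card_fin _) h4

theorem mem_range_mvInvariant_of_involutive {L : Type u} [ResiduatedLattice L] (hL : IsBL L)
    [Finite L] {n : ℕ} (hn : Nat.card L = n) (h : ∀ x : L, rneg (rneg x) = x) :
    idemRanks L ∈ Set.range (blInvariant n ∘ mvToBL n) := by
  obtain ⟨⟨R, hR⟩, e, hinv⟩ := exists_blInvariant_eq hL hn
  obtain ⟨f⟩ := MVAlgebra.nonempty_resIso_ofInvolutive hR (hinv h)
  refine ⟨MVAlgebra.ofInvolutive hR (hinv h), Eq.trans ?_ e⟩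
  exact (@ResIso.idemRanks_eq _ _ R
    (MVAlgebra.ofInvolutive hR (hinv h)).toResiduatedLattice f).symm

theorem mem_range_mvInvariant {k : ℕ} (h4 : k ≤ 4) (S : Set ℕ) :
    S ∈ Set.range (blInvariant (k + 1) ∘ mvToBL (k + 1)) ↔ S = {0, k} ∨ (S = ∅ ∧ k = 3) := by
  constructor
  · rintro ⟨M, rfl⟩
    let R := M.toResiduatedLattice
    have hR : IsBL (Fin (k + 1)) := M.isBL_toResiduatedLattice
    have hinv : ∀ x : Fin (k + 1), rneg (rneg x) = x := M.rneg_rneg_toResiduatedLattice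
    change idemRanks (Fin (k + 1)) = _ ∨ idemRanks (Fin (k + 1)) = _ ∧ _
    by_cases hc : IsChainAlg (Fin (k + 1))
    · left
      obtain ⟨φ, hφ⟩ := IsRanking.exists_of_isChainAlg hc (Nat.card_fin (k + 1))
      ext i
      rw [hφ.mem_idemRanks]
      constructor
      · rintro ⟨x, hx, rfl⟩
        rcases hR.eq_of_idem_of_involutive hinv hx (hc x) with rfl | rfl
        · exact Or.inl hφ.bot
        · exact Or.inr hφ.top
      · rintro (rfl | rfl)
        · exact hφ.idem_zero
        · exact hφ.idem_last
    · right
      refine ⟨idemRanks_eq_empty hc, ?_⟩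
      have h5 := hR.natCard_ne_five_of_involutive hc hinv
      have := (hR.nonchain_cases hc (by rw [Nat.card_fin]; omega)).2
      rw [Nat.card_fin] at this h5
      omega
  · rintro (rfl | ⟨rfl, rfl⟩)
    · obtain ⟨φ, hφ, hφi⟩ := exists_isRanking_ideal_zmod k
      have : Finite (Ideal (ZMod (2 ^ k))) :=
        Nat.finite_of_card_ne_zero (by rw [hφ.natCard]; omega)
      have h := mem_range_mvInvariant_of_involutive (isBL_ideal_zmod k) hφ.natCard
        (hφ.rneg_rneg (isBL_ideal_zmod k) fun i => (hφi i).1)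
      convert h using 1
      ext i
      rw [hφ.mem_idemRanks, hφi]
      rfl
    · obtain ⟨L, _, _, bL, cL, nL, hinv⟩ := exists_nonchain_four
      have h := mem_range_mvInvariant_of_involutive bL nL hinv
      rwa [idemRanks_eq_empty cL] at h

/-- All possible values lie in `{0, …, k}`, so the count becomes a decidable one over finite sets;
`∅` stands for the single non-chain. -/
theorem numBL_succ {k : ℕ} (h1 : 1 ≤ k) (h4 : k ≤ 4) : numBL (k + 1) =
    ((Finset.range (k + 1)).powerset.filter
      fun T => (0 ∈ T ∧ k ∈ T) ∨ (T = ∅ ∧ (k = 3 ∨ k = 4))).card := by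
  rw [numBL_eq_ncard h4, ← Set.ncard_coe_finset,
    ← Set.ncard_image_of_injective _ (Finset.coe_injective (α := ℕ))]
  congr 1
  ext S
  rw [mem_range_blInvariant h1 h4, Set.mem_image]
  constructor
  · rintro (⟨h0, hk, hS⟩ | ⟨rfl, hk⟩)
    · have hfin : S.Finite := (Set.finite_Iic k).subset hS
      refine ⟨hfin.toFinset, ?_, hfin.coe_toFinset⟩
      simp only [Finset.coe_filter, Finset.mem_powerset, Set.mem_ofPred_eq]
      refine ⟨fun i hi => ?_, Or.inl ⟨by simpa, by simpa⟩⟩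
      simpa [Nat.lt_succ_iff] using hS i (by simpa using hi)
    · exact ⟨∅, by simpa using hk, by simp⟩
  · rintro ⟨T, hT, rfl⟩
    simp only [Finset.coe_filter, Finset.mem_powerset, Set.mem_ofPred_eq] at hT
    rcases hT with ⟨hT, ⟨h0, hk⟩ | ⟨rfl, hk⟩⟩
    · exact Or.inl ⟨h0, hk, fun i hi => Nat.lt_succ_iff.1 (Finset.mem_range.1 (hT hi))⟩
    · exact Or.inr ⟨by simp, hk⟩

theorem numMV_succ {k : ℕ} (h4 : k ≤ 4) : numMV (k + 1) = if k = 3 then 2 else 1 := by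
  rw [numMV_eq_ncard h4]
  split_ifs with h3
  · rw [show Set.range (blInvariant (k + 1) ∘ mvToBL (k + 1)) = {{0, k}, ∅} by
      ext S; rw [mem_range_mvInvariant h4]; simp [h3]]
    exact Set.ncard_pair (Set.insert_nonempty _ _).ne_empty
  · rw [show Set.range (blInvariant (k + 1) ∘ mvToBL (k + 1)) = {{0, k}} by
      ext S; rw [mem_range_mvInvariant h4]; simp [h3]]
    exact Set.ncard_singleton _

end Counting

/-! ### Factorizations of primes and of squares of primes -/

section Factorizations

theorem eq_zero_of_prod_eq_one {s : Multiset ℕ} (h : ∀ a ∈ s, 1 < a) (hs : s.prod = 1) : s = 0 :=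
  Multiset.eq_zero_of_forall_notMem fun a ha =>
    (h a ha).ne' (Nat.dvd_one.1 (hs ▸ Multiset.dvd_prod ha))

theorem eq_singleton_of_prod_prime {s : Multiset ℕ} {p : ℕ} (hp : p.Prime) (h : ∀ a ∈ s, 1 < a)
    (hs : s.prod = p) : s = {p} := by
  obtain ⟨a, ha⟩ : ∃ a, a ∈ s := Multiset.exists_mem_of_ne_zero (by
    rintro rfl
    exact hp.one_lt.ne hs)
  obtain ⟨t, rfl⟩ := Multiset.exists_cons_of_mem ha
  rw [Multiset.prod_cons] at hs
  have hap : a = p := ((Nat.dvd_prime hp).1 (hs ▸ dvd_mul_right a t.prod)).resolve_left (h a ha).ne'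
  subst hap
  have ht : t.prod = 1 := by
    have := hp.pos
    nlinarith
  rw [eq_zero_of_prod_eq_one (fun b hb => h b (Multiset.mem_cons_of_mem hb)) ht]
  rfl

theorem numFactorizations_prime {p : ℕ} (hp : p.Prime) : numFactorizations p = 0 := by
  rw [numFactorizations, ← Set.ncard_empty (Multiset ℕ)]
  congr 1
  refine Set.eq_empty_of_forall_notMem ?_
  rintro s ⟨h2, h1, hs⟩
  rw [eq_singleton_of_prod_prime hp h1 hs] at h2
  simp at h2

theorem numFactorizations_prime_sq {p : ℕ} (hp : p.Prime) : numFactorizations (p * p) = 1 := by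
  rw [numFactorizations, Set.ncard_eq_one]
  refine ⟨{p, p}, Set.eq_singleton_iff_unique_mem.2 ⟨⟨by simp, ?_, by simp⟩, ?_⟩⟩
  · intro a ha
    have : a = p := by simpa using ha
    exact this ▸ hp.one_lt
  · rintro s ⟨h2, h1, hs⟩
    obtain ⟨a, ha⟩ : ∃ a, a ∈ s := Multiset.exists_mem_of_ne_zero (by rintro rfl; simp at h2)
    obtain ⟨t, rfl⟩ := Multiset.exists_cons_of_mem ha
    have ht1 : ∀ b ∈ t, 1 < b := fun b hb => h1 b (Multiset.mem_cons_of_mem hb)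
    rw [Multiset.prod_cons] at hs
    have hap : a ∣ p ^ 2 := by rw [sq, ← hs]; exact dvd_mul_right _ _
    obtain ⟨i, hi, rfl⟩ := (Nat.dvd_prime_pow hp).1 hap
    have hpos := hp.pos
    interval_cases i
    · exact absurd (h1 _ ha) (by simp)
    · rw [pow_one] at hs ⊢
      rw [eq_singleton_of_prod_prime hp ht1 (Nat.eq_of_mul_eq_mul_left hpos hs)]
      rfl
    · have ht : t.prod = 1 := by
        refine Nat.eq_of_mul_eq_mul_left (Nat.pow_pos (n := 2) hpos) ?_
        rw [hs, sq, mul_one]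
      rw [eq_zero_of_prod_eq_one ht1 ht] at h2
      simp at h2

end Factorizations

theorem theorem4 :
    (∀ (L : Type u) [ResiduatedLattice L], IsBL L → 2 ≤ Nat.card L → Nat.card L ≤ 5 → ¬ IsMV L →
      ∃ (A B : Type) (iA : ResiduatedLattice A) (iB : ResiduatedLattice B),
        BuiltFromIdeals A iA ∧ BuiltFromIdeals B iB ∧ IsBL A ∧ IsBL B ∧ IsChainAlg A ∧
        Nontrivial A ∧ Nontrivial B ∧ Nonempty (ResIso L (OrdProd A B))) ∧
    (numBL 2 = 1 ∧ numBL 2 = numMV 2 ∧ numBL 2 = numFactorizations 2 + 1) ∧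
    (numBL 3 = 2 ∧ numBL 3 = numMV 3 + numBL 2 ∧
      numBL 3 = numFactorizations 3 + numFactorizations 2 + 2) ∧
    (numBL 4 = 5 ∧ numBL 4 = numMV 4 + numBL 3 + numBL 2 ∧
      numBL 4 = numFactorizations 4 + numFactorizations 3 + 2 * numFactorizations 2 + 4) ∧
    (numBL 5 = 9 ∧ numBL 5 = numMV 5 + numBL 4 + numBL 3 + numBL 2 ∧
      numBL 5 = numFactorizations 5 + numFactorizations 4 + 2 * numFactorizations 3
        + 4 * numFactorizations 2 + 8) := by
  have b2 : numBL 2 = 1 := (numBL_succ (k := 1) (by norm_num) (by norm_num)).trans (by decide)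
  have b3 : numBL 3 = 2 := (numBL_succ (k := 2) (by norm_num) (by norm_num)).trans (by decide)
  have b4 : numBL 4 = 5 := (numBL_succ (k := 3) (by norm_num) (by norm_num)).trans (by decide)
  have b5 : numBL 5 = 9 := (numBL_succ (k := 4) (by norm_num) (by norm_num)).trans (by decide)
  have m2 : numMV 2 = 1 := numMV_succ (k := 1) (by norm_num)
  have m3 : numMV 3 = 1 := numMV_succ (k := 2) (by norm_num)
  have m4 : numMV 4 = 2 := numMV_succ (k := 3) (by norm_num)
  have m5 : numMV 5 = 1 := numMV_succ (k := 4) (by norm_num)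
  have f2 : numFactorizations 2 = 0 := numFactorizations_prime Nat.prime_two
  have f3 : numFactorizations 3 = 0 := numFactorizations_prime Nat.prime_three
  have f4 : numFactorizations 4 = 1 := numFactorizations_prime_sq Nat.prime_two
  have f5 : numFactorizations 5 = 0 := numFactorizations_prime Nat.prime_five
  refine ⟨fun L _ hL h2 h5 hMV => hL.exists_ordProd h2 h5 hMV, ?_⟩
  rw [b2, b3, b4, b5, m2, m3, m4, m5, f2, f3, f4, f5]
  norm_num
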